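/- Let $D\subset\mathbb R^3$ be a bounded open set satisfying the cone condition: there is a finite (nondegenerate) cone $C$ such that every $x\in D$ is the vertex of a cone congruent to $C$ and contained in $D$ (every bounded Lipschitz domain has this property). Let $H^1(D)$ be the real Sobolev space with norm $\|u\|_1=\big(\|u\|_{L^2(D)}^2+\|\nabla u\|_{L^2(D)}^2\big)^{1/2}$ and put $$F(u)(x)=\int_D\frac{u^3(s)}{4\pi|x-s|}\,ds .$$ Then there is $\varepsilon_0>0$, depending only on $D$, such that for every $h\in H^1(D)$ with $\|h\|_1=1$ and every $\varepsilon\in(0,\varepsilon_0)$ the equation $$u=-\frac1\varepsilon F(u)+\varepsilon h$$ has a unique solution $u_\varepsilon$ in $H^1(D)$, and this solution satisfies $\|u_\varepsilon\|_1\le\varepsilon^{2/3}$. (A solution is a $u\in H^1(D)$ such that for almost every $x\in D$ the integral $F(u)(x)$ converges absolutely and the equation holds at $x$.) Moreover, $\lim_{\varepsilon\to0^+}\|u_\varepsilon\|_1=0$. -/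

import Mathlib

open MeasureTheory Set Filter Topology
open scoped ContDiff ENNReal

noncomputable section

/-- Euclidean three-space. -/
abbrev E3 : Type := EuclideanSpace ℝ (Fin 3)

/-- The cone condition: there is a finite cone (height `ρ`, half-angle `arccos κ`) such that every
point of `D` is the vertex of a congruent cone contained in `D`. -/
def ConeCondition (D : Set E3) : Prop :=
  ∃ ρ κ : ℝ, 0 < ρ ∧ 0 < κ ∧ κ < 1 ∧
    ∀ x ∈ D, ∃ ξ : E3, ‖ξ‖ = 1 ∧
      ∀ y : E3, ‖y‖ < ρ → κ * ‖y‖ < inner ℝ ξ y → x + y ∈ D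

/-- `g` is the weak (distributional) gradient of `u` on `D`: integration by parts holds against all
smooth test functions with compact support in `D`, in every direction `v`. -/
def IsWeakGradient (D : Set E3) (u : E3 → ℝ) (g : E3 → E3) : Prop :=
  ∀ φ : E3 → ℝ, ContDiff ℝ ∞ φ → HasCompactSupport φ → tsupport φ ⊆ D → ∀ v : E3,
    ∫ x in D, u x * fderiv ℝ φ x v = -∫ x in D, φ x * inner ℝ (g x) v

/-- A square integrable function times a continuous compactly supported one is integrable. -/
theorem integrable_mul_of_L2 {D : Set E3} {f ψ : E3 → ℝ}
    (hf : MemLp f 2 (volume.restrict D)) (hψ : Continuous ψ) (hc : HasCompactSupport ψ) :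
    Integrable (fun x => f x * ψ x) (volume.restrict D) :=
  hf.integrable_mul ((hψ.memLp_of_hasCompactSupport hc (p := 2) (μ := volume)).restrict D)

theorem integrable_test_left {D : Set E3} {φ : E3 → ℝ} (h1 : ContDiff ℝ ∞ φ)
    (h2 : HasCompactSupport φ) (v : E3) (u : Lp ℝ 2 (volume.restrict D)) :
    Integrable (fun x => u x * fderiv ℝ φ x v) (volume.restrict D) :=
  integrable_mul_of_L2 (Lp.memLp u)
    ((h1.continuous_fderiv (by simp)).clm_apply continuous_const)
    (h2.fderiv_apply (𝕜 := ℝ) v)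

theorem integrable_test_right {D : Set E3} {φ : E3 → ℝ} (h1 : ContDiff ℝ ∞ φ)
    (h2 : HasCompactSupport φ) (v : E3) (g : Lp E3 2 (volume.restrict D)) :
    Integrable (fun x => φ x * inner ℝ (g x) v) (volume.restrict D) := by
  have := integrable_mul_of_L2 ((Lp.memLp g).inner_const (𝕜 := ℝ) v) h1.continuous h2
  simpa only [mul_comm] using this

/-- The Sobolev space `H¹(D)`, with each function paired with its weak gradient:
`{(u, ∇u) : u ∈ L²(D), ∇u ∈ L²(D; ℝ³)}`. Its inherited norm is
`‖u‖_{H¹(D)} = (‖u‖²_{L²(D)} + ‖∇u‖²_{L²(D)})^{1/2}`. -/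
def H1 (D : Set E3) :
    Submodule ℝ (WithLp 2 (Lp ℝ 2 (volume.restrict D) × Lp E3 2 (volume.restrict D))) where
  carrier := {p | IsWeakGradient D p.fst p.snd}
  zero_mem' := by
    intro φ h1 h2 h3 v
    have e1 : ∀ᵐ x ∂(volume.restrict D), (0 : Lp ℝ 2 (volume.restrict D)) x = 0 :=
      Lp.coeFn_zero ℝ 2 _
    have e2 : ∀ᵐ x ∂(volume.restrict D), (0 : Lp E3 2 (volume.restrict D)) x = 0 :=
      Lp.coeFn_zero E3 2 _
    rw [integral_eq_zero_of_ae, integral_eq_zero_of_ae, neg_zero]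
    · filter_upwards [e2] with x hx
      change φ x * inner ℝ ((0 : Lp E3 2 (volume.restrict D)) x) v = 0
      rw [hx, inner_zero_left, mul_zero]
    · filter_upwards [e1] with x hx
      change (0 : Lp ℝ 2 (volume.restrict D)) x * fderiv ℝ φ x v = 0
      rw [hx, zero_mul]
  add_mem' := by
    intro p q hp hq φ h1 h2 h3 v
    have e1 := Lp.coeFn_add p.fst q.fst
    have e2 := Lp.coeFn_add p.snd q.snd
    have a1 : ∫ x in D, (p + q).fst x * fderiv ℝ φ x v
        = ∫ x in D, (p.fst x * fderiv ℝ φ x v + q.fst x * fderiv ℝ φ x v) := by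
      refine integral_congr_ae ?_
      filter_upwards [e1] with x hx
      simp only [WithLp.add_fst, hx, Pi.add_apply]
      ring
    have a2 : ∫ x in D, φ x * inner ℝ ((p + q).snd x) v
        = ∫ x in D, (φ x * inner ℝ (p.snd x) v + φ x * inner ℝ (q.snd x) v) := by
      refine integral_congr_ae ?_
      filter_upwards [e2] with x hx
      simp only [WithLp.add_snd, hx, Pi.add_apply, inner_add_left]
      ring
    rw [a1, a2, integral_add (integrable_test_left h1 h2 v _) (integrable_test_left h1 h2 v _),
      integral_add (integrable_test_right h1 h2 v _) (integrable_test_right h1 h2 v _),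
      hp φ h1 h2 h3 v, hq φ h1 h2 h3 v]
    ring
  smul_mem' := by
    intro c p hp φ h1 h2 h3 v
    have e1 := Lp.coeFn_smul c p.fst
    have e2 := Lp.coeFn_smul c p.snd
    have a1 : ∫ x in D, (c • p).fst x * fderiv ℝ φ x v
        = ∫ x in D, c * (p.fst x * fderiv ℝ φ x v) := by
      refine integral_congr_ae ?_
      filter_upwards [e1] with x hx
      simp only [WithLp.smul_fst, hx, Pi.smul_apply, smul_eq_mul]
      ring
    have a2 : ∫ x in D, φ x * inner ℝ ((c • p).snd x) v
        = ∫ x in D, c * (φ x * inner ℝ (p.snd x) v) := by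
      refine integral_congr_ae ?_
      filter_upwards [e2] with x hx
      simp only [WithLp.smul_snd, hx, Pi.smul_apply, real_inner_smul_left]
      ring
    rw [a1, a2, integral_const_mul, integral_const_mul, hp φ h1 h2 h3 v]
    ring

/-- The function underlying an element of `H¹(D)` (defined up to null sets of `D`). -/
def valueOf {D : Set E3} (u : H1 D) : E3 → ℝ := u.1.fst

/-- The kernel `g(x, s) = 1 / (4π|x - s|)`. -/
def newtonKernel (x s : E3) : ℝ := 1 / (4 * Real.pi * ‖x - s‖)

/-- `F(u)(x) = ∫_D g(x, s) u(s)³ ds`. -/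
def cubicPotential (D : Set E3) (u : E3 → ℝ) (x : E3) : ℝ :=
  ∫ s in D, newtonKernel x s * u s ^ 3

/-- `u ∈ H¹(D)` solves `u = -ε⁻¹ F(u) + ε h`: for almost every `x ∈ D` the integral defining
`F(u)(x)` converges absolutely and the equation holds at `x`. -/
def IsSolution {D : Set E3} (ε : ℝ) (h u : H1 D) : Prop :=
  ∀ᵐ x ∂(volume.restrict D),
    IntegrableOn (fun s => newtonKernel x s * valueOf u s ^ 3) D ∧
      valueOf u x = -ε⁻¹ * cubicPotential D (valueOf u) x + ε * valueOf h x

end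

/-!
The equation is a fixed point equation for `Φ(u) = -ε⁻¹ F(u) + ε h` on `H¹(D)`. It is solved by
contraction on the ball of radius `ε^{2/3}`, and uniqueness among *all* of `H¹(D)` comes from
monotonicity.

*Mapping properties.* Only subcritical estimates are needed. The Sobolev embedding `H¹(D) ⊂ L⁴(D)`
gives `u³ ∈ L^{4/3}(D)`, and the Newtonian potential maps `L^{4/3}(D)` into `H¹(D)`; both statements
reduce to the boundedness `L² → L⁴` and `L^{4/3} → L²` of the Riesz potential with kernel
`|x - y|⁻²` on a bounded set, which is Young's inequality (`eLpNorm_lintegral_mul_le_of_young`)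
because `|z|^{-8/3}` is locally integrable on `ℝ³`. Hence `‖F(u) - F(w)‖₁` is at most
`K ‖u - w‖₁ (‖u‖₁² + ‖u‖₁ ‖w‖₁ + ‖w‖₁²)` (`exists_isCubicPotentialOperator`), and on the ball of
radius `ε^{2/3}` the map `Φ` has Lipschitz constant at most `3 K ε^{1/3}`.

*Sobolev embedding.* The cone condition yields, at every `x ∈ D`, balls of radius `t s` centred at
`x + t p` that stay in `D` for `0 < t ≤ 1`. The averages of `u` against bumps supported in these
balls converge to `u x` at Lebesgue points as `t → 0`, and their derivative in `t` is the weak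
gradient tested against a smooth vector field. Integrating in `t` bounds `|u x|` by the Riesz
potential of `|u| + |∇u|` (`exists_enorm_le_rieszPotential`). The weak formulation is used directly,
without approximation by smooth functions.

*Uniqueness.* For two solutions `u`, `w` put `f = u³ - w³`. Then `u - w = -ε⁻¹ G f` with `G` the
Newtonian potential, so `∫ f (u - w) = -ε⁻¹ ∫ f G f`. The left-hand integrand is nonnegative, and
`∫ f G f ≥ 0` since `1 / |x - y|` is a positive multiple of `∫ |x - z|⁻² |y - z|⁻² dz`
(`integral_mul_newtonPotential_nonneg`). Therefore `f (u - w) = 0` almost everywhere.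
-/

/-! ### Young's inequality for integral operators -/

/-- Young's inequality for an integral operator whose kernel is in `L^r` in each variable, uniformly
in the other, when `1 / p + 1 / r = 1 + 1 / q`. -/
theorem eLpNorm_lintegral_mul_le_of_young {α : Type*} [MeasurableSpace α] {μ : Measure α}
    [SFinite μ] {K : α → α → ℝ≥0∞} (hK : Measurable (Function.uncurry K)) {A : ℝ≥0∞} {f : α → ℝ≥0∞}
    (hf : AEMeasurable f μ) {p q : ℝ≥0∞} {r : ℝ} (hp0 : p ≠ 0) (hpq : p ≤ q) (hq : q ≠ ⊤)
    (hr : 0 < r) (hrq : r ≤ q.toReal)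
    (hpqr : p.toReal⁻¹ + r⁻¹ = 1 + q.toReal⁻¹)
    (hx : ∀ᵐ x ∂μ, ∫⁻ y, K x y ^ r ∂μ ≤ A) (hy : ∀ᵐ y ∂μ, ∫⁻ x, K x y ^ r ∂μ ≤ A) :
    eLpNorm (fun x => ∫⁻ y, K x y * f y ∂μ) q μ ≤ A ^ r⁻¹ * eLpNorm f p μ := by
  have hp : p ≠ ⊤ := ne_top_of_le_ne_top hq hpq
  have hq0 : q ≠ 0 := (lt_of_lt_of_le (pos_iff_ne_zero.2 hp0) hpq).ne'
  set P := p.toReal with hP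
  set Q := q.toReal with hQ
  have hP0 : 0 < P := ENNReal.toReal_pos hp0 hp
  have hQ0 : 0 < Q := ENNReal.toReal_pos hq0 hq
  have hPQ : P ≤ Q := ENNReal.toReal_mono hq hpq
  set b : ℝ := r⁻¹ - Q⁻¹ with hb
  set c : ℝ := P⁻¹ - Q⁻¹ with hc
  have hb0 : 0 ≤ b := sub_nonneg.2 (inv_anti₀ hr hrq)
  have hc0 : 0 ≤ c := sub_nonneg.2 (inv_anti₀ hP0 hPQ)
  have hQi : 0 ≤ Q⁻¹ := by positivity
  set M := ∫⁻ y, f y ^ P ∂μ with hM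
  have hKx : ∀ x, Measurable (K x) := fun x => hK.comp measurable_prodMk_left
  -- Hölder's inequality for `K f = (K ^ r f ^ p) ^ (1 / q) (K ^ r) ^ b (f ^ p) ^ c`
  have key : ∀ x, ∫⁻ y, K x y * f y ∂μ ≤
      (∫⁻ y, K x y ^ r * f y ^ P ∂μ) ^ Q⁻¹ * ((∫⁻ y, K x y ^ r ∂μ) ^ b * M ^ c) := by
    intro x
    have := ENNReal.lintegral_prod_norm_pow_le (μ := μ) (Finset.univ : Finset (Fin 3))
      (f := ![fun y => K x y ^ r * f y ^ P, fun y => K x y ^ r, fun y => f y ^ P])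
      (p := ![Q⁻¹, b, c]) ?_ ?_ ?_
    · simp only [Fin.prod_univ_three, Matrix.cons_val_zero, Matrix.cons_val_one,
        Matrix.cons_val] at this
      rw [mul_assoc] at this
      refine le_trans (le_of_eq (lintegral_congr fun y => ?_)) this
      have e1 : r * Q⁻¹ + r * b = 1 := by rw [hb]; field_simp; ring
      have e2 : P * Q⁻¹ + P * c = 1 := by rw [hc]; field_simp; ring
      rw [ENNReal.mul_rpow_of_nonneg _ _ hQi]
      simp only [← ENNReal.rpow_mul]
      calc K x y * f y
          = (K x y ^ (r * Q⁻¹) * K x y ^ (r * b)) * (f y ^ (P * Q⁻¹) * f y ^ (P * c)) := by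
            rw [← ENNReal.rpow_add_of_nonneg _ _ (by positivity) (by positivity),
              ← ENNReal.rpow_add_of_nonneg _ _ (by positivity) (by positivity), e1, e2,
              ENNReal.rpow_one, ENNReal.rpow_one]
        _ = _ := by ring
    · intro i _
      fin_cases i
      · exact ((hKx x).pow_const r).aemeasurable.mul (hf.pow_const P)
      · exact ((hKx x).pow_const r).aemeasurable
      · exact hf.pow_const P
    · simp only [Fin.sum_univ_three, Matrix.cons_val_zero, Matrix.cons_val_one,
        Matrix.cons_val]
      linarith
    · intro i _
      fin_cases i
      · exact hQi
      · exact hb0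
      · exact hc0
  have hdouble : ∫⁻ x, ∫⁻ y, K x y ^ r * f y ^ P ∂μ ∂μ ≤ A * M := by
    rw [lintegral_lintegral_swap]
    · calc ∫⁻ y, ∫⁻ x, K x y ^ r * f y ^ P ∂μ ∂μ
          = ∫⁻ y, (∫⁻ x, K x y ^ r ∂μ) * f y ^ P ∂μ := by
            refine lintegral_congr fun y => ?_
            rw [lintegral_mul_const]
            exact (hK.comp measurable_prodMk_right).pow_const r
        _ ≤ ∫⁻ y, A * f y ^ P ∂μ := by
            refine lintegral_mono_ae ?_
            filter_upwards [hy] with y hy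
            gcongr
        _ = A * M := lintegral_const_mul'' _ (hf.pow_const P)
    · exact (hK.pow_const r).aemeasurable.mul
        ((hf.pow_const P).comp_quasiMeasurePreserving Measure.quasiMeasurePreserving_snd)
  rw [eLpNorm_eq_lintegral_rpow_enorm_toReal hq0 hq, eLpNorm_eq_lintegral_rpow_enorm_toReal hp0 hp]
  simp only [enorm_eq_self, ← hP, ← hQ, one_div, ← hM]
  have hbound : ∫⁻ x, (∫⁻ y, K x y * f y ∂μ) ^ Q ∂μ ≤ (A * M) * (A ^ b * M ^ c) ^ Q := by
    calc ∫⁻ x, (∫⁻ y, K x y * f y ∂μ) ^ Q ∂μ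
        ≤ ∫⁻ x, (∫⁻ y, K x y ^ r * f y ^ P ∂μ) * (A ^ b * M ^ c) ^ Q ∂μ := by
          refine lintegral_mono_ae ?_
          filter_upwards [hx] with x hx
          refine (ENNReal.rpow_le_rpow (key x) hQ0.le).trans ?_
          rw [ENNReal.mul_rpow_of_nonneg _ _ hQ0.le, ← ENNReal.rpow_mul, inv_mul_cancel₀ hQ0.ne',
            ENNReal.rpow_one]
          gcongr
      _ = (∫⁻ x, ∫⁻ y, K x y ^ r * f y ^ P ∂μ ∂μ) * (A ^ b * M ^ c) ^ Q := by
          refine lintegral_mul_const'' _ ?_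
          exact AEMeasurable.lintegral_prod_right' (f := fun z : α × α => K z.1 z.2 ^ r * f z.2 ^ P)
            ((hK.pow_const r).aemeasurable.mul
            ((hf.pow_const P).comp_quasiMeasurePreserving Measure.quasiMeasurePreserving_snd))
      _ ≤ _ := by gcongr
  refine (ENNReal.rpow_le_rpow hbound hQi).trans (le_of_eq ?_)
  rw [ENNReal.mul_rpow_of_nonneg _ _ hQi, ← ENNReal.rpow_mul, mul_inv_cancel₀ hQ0.ne',
    ENNReal.rpow_one, ENNReal.mul_rpow_of_nonneg _ _ hQi, mul_mul_mul_comm,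
    ← ENNReal.rpow_add_of_nonneg _ _ hQi hb0, ← ENNReal.rpow_add_of_nonneg _ _ hQi hc0, hb, hc]
  congr 2 <;> ring

/-! ### The Riesz potential on a bounded set -/

/-- The Riesz potential of order one, `∫_D f(y) / |x - y|² dy`, of an `ℝ≥0∞`-valued function
(without the normalizing constant). The value `0` of the kernel on the diagonal is immaterial. -/
noncomputable def rieszPotential (D : Set E3) (f : E3 → ℝ≥0∞) (x : E3) : ℝ≥0∞ :=
  ∫⁻ y in D, ENNReal.ofReal (‖x - y‖ ^ 2)⁻¹ * f y

theorem lintegral_comp_sub_le {D : Set E3} (hDm : MeasurableSet D) {R : ℝ}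
    (hD : D ⊆ Metric.ball 0 R) (f : E3 → ℝ≥0∞) {x : E3} (hx : x ∈ D) :
    ∫⁻ y in D, f (x - y) ≤ ∫⁻ z in Metric.ball 0 (2 * R), f z := by
  rw [← lintegral_indicator Metric.isOpen_ball.measurableSet]
  calc ∫⁻ y in D, f (x - y)
      = ∫⁻ y in D, (Metric.ball 0 (2 * R)).indicator f (x - y) := by
        refine setLIntegral_congr_fun hDm fun y hy => ?_
        have h1 := mem_ball_zero_iff.1 (hD hx)
        have h2 := mem_ball_zero_iff.1 (hD hy)
        have h3 := norm_sub_le x y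
        rw [indicator_of_mem]
        exact mem_ball_zero_iff.2 (by linarith)
    _ ≤ ∫⁻ y, (Metric.ball 0 (2 * R)).indicator f (x - y) := setLIntegral_le_lintegral _ _
    _ = ∫⁻ z, (Metric.ball 0 (2 * R)).indicator f z := lintegral_sub_left_eq_self _ x

theorem integrableOn_ball_inv_rpow {a : ℝ} (ha : a < 3) (R : ℝ) :
    IntegrableOn (fun z : E3 => ‖z‖ ^ (-a)) (Metric.ball 0 R) := by
  have hd : Module.finrank ℝ E3 = 3 := by simp
  refine integrableOn_ball_of_norm_le_rpow (by rw [hd]; norm_num) (α := a) (C := 1)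
    (by rw [hd]; exact_mod_cast ha) ?_ ?_
  · refine Eventually.of_forall fun x => ?_
    rw [Real.norm_of_nonneg (by positivity), one_mul]
  · exact (measurable_norm.pow_const _).aestronglyMeasurable

theorem exists_lintegral_rieszKernel_rpow_le {D : Set E3} (hD : MeasurableSet D)
    (hb : Bornology.IsBounded D) :
    ∃ A : ℝ≥0∞, A ≠ ⊤ ∧ ∀ x ∈ D,
      ∫⁻ y in D, ENNReal.ofReal (‖x - y‖ ^ 2)⁻¹ ^ (4 / 3 : ℝ) ≤ A := by
  obtain ⟨R, hR⟩ := hb.subset_ball 0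
  refine ⟨∫⁻ z in Metric.ball (0 : E3) (2 * R), ENNReal.ofReal (‖z‖ ^ 2)⁻¹ ^ (4 / 3 : ℝ), ?_,
    fun x hx => lintegral_comp_sub_le hD hR (fun z => ENNReal.ofReal (‖z‖ ^ 2)⁻¹ ^ (4 / 3 : ℝ)) hx⟩
  have h := (integrableOn_ball_inv_rpow (a := 8 / 3) (by norm_num) (2 * R)).lintegral_lt_top
  refine (lt_of_le_of_lt (le_of_eq ?_) h).ne
  refine lintegral_congr fun z => ?_
  rw [ENNReal.ofReal_rpow_of_nonneg (by positivity) (by norm_num)]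
  congr 1
  rw [← Real.rpow_natCast, ← Real.rpow_neg (norm_nonneg _), ← Real.rpow_mul (norm_nonneg _)]
  norm_num

theorem measurable_rieszKernel :
    Measurable (Function.uncurry fun x y : E3 => ENNReal.ofReal (‖x - y‖ ^ 2)⁻¹) := by
  unfold Function.uncurry
  fun_prop

/-- In dimension three the Riesz potential of order one maps `L²` into `L⁴` on bounded sets. -/
theorem exists_eLpNorm_rieszPotential_four_le {D : Set E3} (hD : MeasurableSet D)
    (hb : Bornology.IsBounded D) :
    ∃ A : ℝ≥0∞, A ≠ ⊤ ∧ ∀ f : E3 → ℝ≥0∞, AEMeasurable f (volume.restrict D) →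
      eLpNorm (rieszPotential D f) 4 (volume.restrict D)
        ≤ A * eLpNorm f 2 (volume.restrict D) := by
  obtain ⟨A, hA, h⟩ := exists_lintegral_rieszKernel_rpow_le hD hb
  refine ⟨A ^ (4 / 3 : ℝ)⁻¹, ENNReal.rpow_ne_top_of_nonneg (by norm_num) hA, fun f hf => ?_⟩
  refine eLpNorm_lintegral_mul_le_of_young (r := 4 / 3) measurable_rieszKernel hf
    (by norm_num) (by norm_num) (by norm_num) (by norm_num) (by norm_num) (by norm_num) ?_ ?_
  · filter_upwards [ae_restrict_mem hD] with x hx using h x hx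
  · filter_upwards [ae_restrict_mem hD] with x hx
    simpa only [norm_sub_rev] using h x hx

/-- In dimension three the Riesz potential of order one maps `L^{4/3}` into `L²` on bounded
sets. -/
theorem exists_eLpNorm_rieszPotential_two_le {D : Set E3} (hD : MeasurableSet D)
    (hb : Bornology.IsBounded D) :
    ∃ A : ℝ≥0∞, A ≠ ⊤ ∧ ∀ f : E3 → ℝ≥0∞, AEMeasurable f (volume.restrict D) →
      eLpNorm (rieszPotential D f) 2 (volume.restrict D)
        ≤ A * eLpNorm f (4 / 3) (volume.restrict D) := by
  obtain ⟨A, hA, h⟩ := exists_lintegral_rieszKernel_rpow_le hD hb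
  refine ⟨A ^ (4 / 3 : ℝ)⁻¹, ENNReal.rpow_ne_top_of_nonneg (by norm_num) hA, fun f hf => ?_⟩
  have h43 : (4 / 3 : ℝ≥0∞) ≤ 2 := by
    refine ENNReal.div_le_of_le_mul ?_
    norm_num
  refine eLpNorm_lintegral_mul_le_of_young (r := 4 / 3) measurable_rieszKernel hf
    (by simp) h43
    (by norm_num) (by norm_num) (by norm_num) (by norm_num) ?_ ?_
  · filter_upwards [ae_restrict_mem hD] with x hx using h x hx
  · filter_upwards [ae_restrict_mem hD] with x hx
    simpa only [norm_sub_rev] using h x hx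

/-! ### Averages over shrinking bumps and the weak gradient -/

theorem mem_closedBall_of_bump_ne_zero {ψ : E3 → ℝ} {s : ℝ}
    (hs : tsupport ψ ⊆ Metric.closedBall 0 s) {p x y : E3} {t : ℝ} (ht : 0 < t)
    (h : t⁻¹ • (y - x) - p ∈ tsupport ψ) : y ∈ Metric.closedBall (x + t • p) (t * s) := by
  have h1 := mem_closedBall_zero_iff.1 (hs h)
  have h2 : y - (x + t • p) = t • (t⁻¹ • (y - x) - p) := by
    rw [smul_sub, smul_smul, mul_inv_cancel₀ ht.ne', one_smul]; abel
  rw [mem_closedBall_iff_norm, h2, norm_smul, Real.norm_of_nonneg ht.le]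
  gcongr

theorem norm_sub_bounds_of_mem_closedBall {p x y : E3} {t s : ℝ} (ht : 0 < t)
    (h : y ∈ Metric.closedBall (x + t • p) (t * s)) :
    t * (‖p‖ - s) ≤ ‖x - y‖ ∧ ‖x - y‖ ≤ t * (‖p‖ + s) := by
  rw [mem_closedBall_iff_norm] at h
  have e : t * ‖p‖ = ‖t • p‖ := by rw [norm_smul, Real.norm_of_nonneg ht.le]
  have h1 := norm_sub_le (y - (x + t • p)) (y - x)
  have h2 := norm_add_le (y - (x + t • p)) (t • p)
  have e1 : y - (x + t • p) - (y - x) = -(t • p) := by abel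
  have e2 : y - (x + t • p) + t • p = y - x := by abel
  rw [e1, norm_neg] at h1
  rw [e2] at h2
  rw [norm_sub_rev x y, mul_sub, mul_add, e]
  constructor <;> linarith

/-- The weak gradient tested against the vector field `y ↦ ψ((y - x) / t - p) (y - x)`, whose
divergence appears on the left. -/
theorem IsWeakGradient.integral_mul_divergence {D : Set E3} {u : E3 → ℝ} {g : E3 → E3}
    (hu : MemLp u 2 (volume.restrict D)) (hg : MemLp g 2 (volume.restrict D))
    (hw : IsWeakGradient D u g) {ψ : E3 → ℝ} (hψ : ContDiff ℝ ∞ ψ) {s : ℝ}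
    (hs : tsupport ψ ⊆ Metric.closedBall 0 s) {p x : E3} {t : ℝ} (ht : 0 < t)
    (hD : Metric.closedBall (x + t • p) (t * s) ⊆ D) :
    ∫ y in D, u y * (3 * ψ (t⁻¹ • (y - x) - p)
        + fderiv ℝ ψ (t⁻¹ • (y - x) - p) (t⁻¹ • (y - x)))
      = -∫ y in D, ψ (t⁻¹ • (y - x) - p) * inner ℝ (g y) (y - x) := by
  set e : Fin 3 → E3 := fun i => EuclideanSpace.basisFun (Fin 3) ℝ i with he
  set φ : Fin 3 → E3 → ℝ := fun i y => ψ (t⁻¹ • (y - x) - p) * inner ℝ (e i) (y - x) with hφ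
  have hφc : ∀ i, ContDiff ℝ ∞ (φ i) := by
    intro i
    refine (hψ.comp ?_).mul ?_
    · fun_prop
    · exact (innerSL ℝ (e i)).contDiff.comp (contDiff_id.sub contDiff_const)
  have hsub : ∀ i, tsupport (φ i) ⊆ Metric.closedBall (x + t • p) (t * s) := by
    intro i
    refine closure_minimal (fun y hy => ?_) Metric.isClosed_closedBall
    refine mem_closedBall_of_bump_ne_zero hs ht (subset_tsupport _ ?_)
    exact left_ne_zero_of_mul hy
  have hcs : ∀ i, HasCompactSupport (φ i) := fun i =>
    HasCompactSupport.of_support_subset_isCompact (isCompact_closedBall _ _)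
      ((subset_tsupport _).trans (hsub i))
  have hder : ∀ i y, fderiv ℝ (φ i) y (e i) = ψ (t⁻¹ • (y - x) - p)
      + inner ℝ (e i) (y - x) * fderiv ℝ ψ (t⁻¹ • (y - x) - p) (t⁻¹ • e i) := by
    intro i y
    have h1 : HasFDerivAt (fun y : E3 => t⁻¹ • (y - x) - p) (t⁻¹ • ContinuousLinearMap.id ℝ E3) y :=
      (((hasFDerivAt_id y).sub_const x).const_smul t⁻¹).sub_const p
    have h2 : HasFDerivAt (fun y : E3 => ψ (t⁻¹ • (y - x) - p)) _ y :=
      ((hψ.differentiable (by simp)) (t⁻¹ • (y - x) - p)).hasFDerivAt.comp y h1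
    have h3 : HasFDerivAt (fun y : E3 => inner ℝ (e i) (y - x)) (innerSL ℝ (e i)) y :=
      (innerSL ℝ (e i)).hasFDerivAt.comp y ((hasFDerivAt_id y).sub_const x)
    have h5 : HasFDerivAt (φ i) _ y := h2.mul h3
    rw [h5.fderiv]
    have h4 : ‖e i‖ = 1 := by simp [he]
    simp [h4]
  have hsum : ∀ y : E3, ∑ i, inner ℝ (e i) (y - x) • e i = y - x := fun y =>
    (EuclideanSpace.basisFun (Fin 3) ℝ).sum_repr' (y - x)
  have hsumL : ∀ (L : E3 →L[ℝ] ℝ) (y : E3), ∑ i, inner ℝ (e i) (y - x) * L (e i) = L (y - x) := by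
    intro L y
    conv_rhs => rw [← hsum y, map_sum]
    simp
  have hi1 : ∀ i, Integrable (fun y => u y * fderiv ℝ (φ i) y (e i)) (volume.restrict D) :=
    fun i => integrable_mul_of_L2 hu
      (((hφc i).continuous_fderiv (by simp)).clm_apply continuous_const)
      ((hcs i).fderiv_apply (𝕜 := ℝ) (e i))
  have hi2 : ∀ i, Integrable (fun y => φ i y * inner ℝ (g y) (e i)) (volume.restrict D) := by
    intro i
    have := integrable_mul_of_L2 (hg.inner_const (𝕜 := ℝ) (e i)) (hφc i).continuous (hcs i)
    simpa only [mul_comm] using this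
  calc ∫ y in D, u y * (3 * ψ (t⁻¹ • (y - x) - p)
        + fderiv ℝ ψ (t⁻¹ • (y - x) - p) (t⁻¹ • (y - x)))
      = ∫ y in D, ∑ i, u y * fderiv ℝ (φ i) y (e i) := by
        refine integral_congr_ae (Eventually.of_forall fun y => ?_)
        simp only [hder]
        rw [← Finset.mul_sum, Finset.sum_add_distrib]
        congr 2
        · simp
        · rw [map_smul, ← hsumL, smul_eq_mul, Finset.mul_sum]
          refine Finset.sum_congr rfl fun i _ => ?_
          rw [map_smul, smul_eq_mul]
          ring
    _ = -∑ i, ∫ y in D, φ i y * inner ℝ (g y) (e i) := by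
        rw [integral_finsetSum _ fun i _ => hi1 i, ← Finset.sum_neg_distrib]
        exact Finset.sum_congr rfl fun i _ => hw (φ i) (hφc i) (hcs i) ((hsub i).trans hD) (e i)
    _ = -∫ y in D, ∑ i, φ i y * inner ℝ (g y) (e i) := by
        rw [integral_finsetSum _ fun i _ => hi2 i]
    _ = _ := by
        congr 1
        refine integral_congr_ae (Eventually.of_forall fun y => ?_)
        simp only [hφ]
        rw [← innerSL_apply_apply ℝ (g y) (y - x), ← hsumL, Finset.mul_sum]
        refine Finset.sum_congr rfl fun i _ => ?_
        rw [innerSL_apply_apply, mul_assoc]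

/-- The derivative in the scale `t` is a divergence: up to the factor `-t⁻⁴` it is the integrand of
`IsWeakGradient.integral_mul_divergence`. -/
theorem hasDerivAt_scaled_bump {ψ : E3 → ℝ} (hψ : ContDiff ℝ ∞ ψ) (p z : E3) {t : ℝ} (ht : t ≠ 0) :
    HasDerivAt (fun t : ℝ => (t ^ 3)⁻¹ * ψ (t⁻¹ • z - p))
      (-(t ^ 4)⁻¹ * (3 * ψ (t⁻¹ • z - p) + fderiv ℝ ψ (t⁻¹ • z - p) (t⁻¹ • z))) t := by
  have h1 : HasDerivAt (fun t : ℝ => t⁻¹ • z - p) ((-(t ^ 2)⁻¹) • z) t :=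
    ((hasDerivAt_inv ht).smul_const z).sub_const p
  have h2 : HasDerivAt (fun t : ℝ => ψ (t⁻¹ • z - p)) _ t :=
    ((hψ.differentiable (by simp)) (t⁻¹ • z - p)).hasFDerivAt.comp_hasDerivAt t h1
  have h3 := ((hasDerivAt_pow 3 t).inv (pow_ne_zero 3 ht)).mul h2
  refine h3.congr_deriv ?_
  simp only [map_smul, smul_eq_mul, Pi.inv_apply]
  push_cast
  field_simp
  ring

/-- For fixed `y` the bump at scale `t` is nonzero at `y` only if `t` is comparable to `|x - y|`, so
integrating over the scales produces the kernel `|x - y|⁻²`. -/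
theorem lintegral_scaled_bump_le {ψ : E3 → ℝ} {s M : ℝ} (hs0 : 0 < s)
    (hs : tsupport ψ ⊆ Metric.closedBall 0 s) (hM : ∀ w, ψ w ≤ M) (hψ0 : ∀ w, 0 ≤ ψ w) {p : E3}
    (hp : s < ‖p‖) {x y : E3} (hxy : x ≠ y) {δ : ℝ} (hδ : 0 < δ) :
    ∫⁻ t in Ioc δ 1, ENNReal.ofReal ((t ^ 4)⁻¹ * ψ (t⁻¹ • (y - x) - p) * ‖x - y‖)
      ≤ ENNReal.ofReal (M * (‖p‖ + s) ^ 4 / (‖p‖ - s)) * ENNReal.ofReal (‖x - y‖ ^ 2)⁻¹ := by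
  set d := ‖x - y‖ with hd
  have hd0 : 0 < d := norm_pos_iff.2 (sub_ne_zero.2 hxy)
  set a := ‖p‖ - s with ha
  set b := ‖p‖ + s with hb
  have ha0 : 0 < a := sub_pos.2 hp
  have hb0 : 0 < b := by positivity
  have hM0 : 0 ≤ M := (hψ0 0).trans (hM 0)
  calc ∫⁻ t in Ioc δ 1, ENNReal.ofReal ((t ^ 4)⁻¹ * ψ (t⁻¹ • (y - x) - p) * d)
      ≤ ∫⁻ t in Ioc δ 1, (Icc (d / b) (d / a)).indicator
          (fun _ => ENNReal.ofReal (M * b ^ 4 * (d ^ 3)⁻¹)) t := by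
        refine setLIntegral_mono' measurableSet_Ioc fun t ht => ?_
        have ht0 : 0 < t := hδ.trans ht.1
        by_cases h : t⁻¹ • (y - x) - p ∈ tsupport ψ
        · obtain ⟨h1, h2⟩ := norm_sub_bounds_of_mem_closedBall ht0
            (mem_closedBall_of_bump_ne_zero hs ht0 h)
          have h3 : d / b ≤ t := by rw [div_le_iff₀ hb0]; exact h2
          have h4 : t ≤ d / a := by rw [le_div_iff₀ ha0]; exact h1
          rw [indicator_of_mem (show t ∈ Icc (d / b) (d / a) from ⟨h3, h4⟩)]
          refine ENNReal.ofReal_le_ofReal ?_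
          calc (t ^ 4)⁻¹ * ψ (t⁻¹ • (y - x) - p) * d ≤ ((d / b) ^ 4)⁻¹ * M * d := by
                gcongr
                · exact hψ0 _
                · exact hM _
            _ = M * b ^ 4 * (d ^ 3)⁻¹ := by field_simp
        · rw [image_eq_zero_of_notMem_tsupport h]
          simp
    _ ≤ ∫⁻ t, (Icc (d / b) (d / a)).indicator
          (fun _ => ENNReal.ofReal (M * b ^ 4 * (d ^ 3)⁻¹)) t := setLIntegral_le_lintegral _ _
    _ = ENNReal.ofReal (M * b ^ 4 * (d ^ 3)⁻¹) * ENNReal.ofReal (d / a - d / b) := by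
        rw [lintegral_indicator measurableSet_Icc, setLIntegral_const, Real.volume_Icc]
    _ ≤ ENNReal.ofReal (M * b ^ 4 * (d ^ 3)⁻¹) * ENNReal.ofReal (d / a) := by
        gcongr
        have : 0 ≤ d / b := by positivity
        linarith
    _ = _ := by
        rw [← ENNReal.ofReal_mul (by positivity), ← ENNReal.ofReal_mul (by positivity)]
        congr 1
        field_simp

theorem hasCompactSupport_of_tsupport_subset_closedBall {ψ : E3 → ℝ} {s : ℝ}
    (hs : tsupport ψ ⊆ Metric.closedBall 0 s) : HasCompactSupport ψ :=
  HasCompactSupport.of_support_subset_isCompact (isCompact_closedBall _ _)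
    ((subset_tsupport _).trans hs)

/-- The fundamental theorem of calculus in the scale `t`: the averages of `u` against the normalized
bumps at scales `1` and `δ` differ by at most the Riesz potential of the weak gradient. -/
theorem enorm_average_sub_average_le {D : Set E3} [IsFiniteMeasure (volume.restrict D)]
    {u : E3 → ℝ} {g : E3 → E3}
    (hu : MemLp u 2 (volume.restrict D)) (hg : MemLp g 2 (volume.restrict D))
    (hw : IsWeakGradient D u g) {ψ : E3 → ℝ} (hψ : ContDiff ℝ ∞ ψ) {s M : ℝ} (hs0 : 0 < s)
    (hs : tsupport ψ ⊆ Metric.closedBall 0 s) (hM : ∀ w, ψ w ≤ M) (hψ0 : ∀ w, 0 ≤ ψ w)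
    {p x : E3} (hp : s < ‖p‖)
    (hD : ∀ t ∈ Ioc (0 : ℝ) 1, Metric.closedBall (x + t • p) (t * s) ⊆ D)
    {δ : ℝ} (hδ : δ ∈ Ioc (0 : ℝ) 1) :
    ‖(∫ y in D, u y * ((1 ^ 3)⁻¹ * ψ ((1 : ℝ)⁻¹ • (y - x) - p)))
      - ∫ y in D, u y * ((δ ^ 3)⁻¹ * ψ (δ⁻¹ • (y - x) - p))‖ₑ
      ≤ ENNReal.ofReal (M * (‖p‖ + s) ^ 4 / (‖p‖ - s)) *
        rieszPotential D (fun y => ‖g y‖ₑ) x := by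
  have hcs := hasCompactSupport_of_tsupport_subset_closedBall hs
  have hui : Integrable u (volume.restrict D) := hu.integrable (by norm_num)
  -- `-t⁻⁴ H((y - x) / t - p)` is the `t`-derivative of the bump; `H` is bounded
  set H : E3 → ℝ := fun w => 3 * ψ w + fderiv ℝ ψ w (w + p) with hH
  have hHc : Continuous H := (continuous_const.mul hψ.continuous).add
    ((hψ.continuous_fderiv (by simp)).clm_apply (continuous_id.add continuous_const))
  have hHs : HasCompactSupport H := by
    refine HasCompactSupport.of_support_subset_isCompact hcs fun w hw => ?_
    by_contra h
    refine hw ?_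
    have h1 : fderiv ℝ ψ w = 0 := by
      by_contra h2
      exact h (support_fderiv_subset ℝ h2)
    simp [hH, h1, image_eq_zero_of_notMem_tsupport h]
  obtain ⟨B, hB⟩ := hHc.bounded_above_of_compact_support hHs
  have hB0 : 0 ≤ B := (norm_nonneg _).trans (hB 0)
  set Φ' : ℝ → E3 → ℝ := fun t y => -(t ^ 4)⁻¹ * H (t⁻¹ • (y - x) - p) with hΦ'
  have hmeas : Measurable (Function.uncurry fun (y : E3) (t : ℝ) => Φ' t y) := by
    have : Measurable fun z : E3 × ℝ => H (z.2⁻¹ • (z.1 - x) - p) :=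
      hHc.measurable.comp (by fun_prop)
    exact ((measurable_snd.pow_const 4).inv.neg).mul this
  have hbd : ∀ t ∈ Ioc δ 1, ∀ y, ‖Φ' t y‖ ≤ (δ ^ 4)⁻¹ * B := by
    intro t ht y
    have ht0 : 0 < t := hδ.1.trans ht.1
    rw [hΦ', norm_mul, norm_neg, norm_inv, norm_pow, Real.norm_of_nonneg ht0.le]
    have := hδ.1
    gcongr
    · exact ht.1.le
    · exact hB _
  have hftc : ∀ y, ∫ t in Ioc δ 1, Φ' t y
      = (1 ^ 3)⁻¹ * ψ ((1 : ℝ)⁻¹ • (y - x) - p) - (δ ^ 3)⁻¹ * ψ (δ⁻¹ • (y - x) - p) := by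
    intro y
    rw [← intervalIntegral.integral_of_le hδ.2]
    refine intervalIntegral.integral_eq_sub_of_hasDerivAt
      (f := fun t : ℝ => (t ^ 3)⁻¹ * ψ (t⁻¹ • (y - x) - p)) (fun t ht => ?_) ?_
    · rw [uIcc_of_le hδ.2] at ht
      refine (hasDerivAt_scaled_bump hψ p (y - x) (hδ.1.trans_le ht.1).ne').congr_deriv ?_
      simp [hΦ', hH]
    · rw [intervalIntegrable_iff_integrableOn_Ioc_of_le hδ.2]
      refine Measure.integrableOn_of_bounded (M := (δ ^ 4)⁻¹ * B) (by simp) ?_ ?_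
      · exact (hmeas.comp (measurable_prodMk_left (x := y))).aestronglyMeasurable
      · filter_upwards [ae_restrict_mem measurableSet_Ioc] with t ht using hbd t ht y
  have hint : Integrable (Function.uncurry fun (y : E3) (t : ℝ) => u y * Φ' t y)
      ((volume.restrict D).prod (volume.restrict (Ioc δ 1))) := by
    have h1 : Integrable (fun z : E3 × ℝ => u z.1 * ((δ ^ 4)⁻¹ * B))
        ((volume.restrict D).prod (volume.restrict (Ioc δ 1))) :=
      hui.mul_prod (integrable_const _)
    refine h1.mono ?_ ?_
    · exact (hui.aestronglyMeasurable.comp_quasiMeasurePreserving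
        Measure.quasiMeasurePreserving_fst).mul hmeas.aestronglyMeasurable
    · have h2 : ∀ᵐ z : E3 × ℝ ∂((volume.restrict D).prod (volume.restrict (Ioc δ 1))),
          z.2 ∈ Ioc δ 1 :=
        Measure.quasiMeasurePreserving_snd.ae (ae_restrict_mem measurableSet_Ioc)
      filter_upwards [h2] with z hz
      simp only [Function.uncurry, norm_mul]
      gcongr
      refine (hbd _ hz _).trans (le_of_eq ?_)
      rw [← norm_mul, Real.norm_of_nonneg]
      have := hδ.1
      positivity
  have hψi : ∀ t : ℝ, 0 < t →
      Integrable (fun y => u y * ((t ^ 3)⁻¹ * ψ (t⁻¹ • (y - x) - p))) (volume.restrict D) := by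
    intro t _
    refine hui.mul_bdd (c := (t ^ 3)⁻¹ * M) ?_ ?_
    · have : Continuous fun y => (t ^ 3)⁻¹ * ψ (t⁻¹ • (y - x) - p) :=
        continuous_const.mul (hψ.continuous.comp (by fun_prop))
      exact this.aestronglyMeasurable
    · refine Eventually.of_forall fun y => ?_
      rw [Real.norm_of_nonneg (mul_nonneg (by positivity) (hψ0 _))]
      gcongr
      exact hM _
  have hrepr : (∫ y in D, u y * ((1 ^ 3)⁻¹ * ψ ((1 : ℝ)⁻¹ • (y - x) - p)))
      - ∫ y in D, u y * ((δ ^ 3)⁻¹ * ψ (δ⁻¹ • (y - x) - p))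
      = ∫ t in Ioc δ 1, ∫ y in D, (t ^ 4)⁻¹ * (ψ (t⁻¹ • (y - x) - p) * inner ℝ (g y) (y - x)) := by
    rw [← integral_sub (hψi 1 one_pos) (hψi δ hδ.1)]
    calc _ = ∫ y in D, ∫ t in Ioc δ 1, u y * Φ' t y := by
          refine integral_congr_ae (Eventually.of_forall fun y => ?_)
          simp only
          rw [integral_const_mul, hftc, mul_sub]
      _ = ∫ t in Ioc δ 1, ∫ y in D, u y * Φ' t y := integral_integral_swap hint
      _ = _ := by
          refine setIntegral_congr_fun measurableSet_Ioc fun t ht => ?_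
          have ht0 : 0 < t := hδ.1.trans ht.1
          have := hw.integral_mul_divergence hu hg hψ hs ht0 (hD t ⟨ht0, ht.2⟩)
          rw [integral_const_mul, ← neg_eq_iff_eq_neg.2 this, ← integral_neg, ← integral_const_mul]
          refine integral_congr_ae (Eventually.of_forall fun y => ?_)
          simp only [hΦ', hH, sub_add_cancel]
          ring
  rw [hrepr]
  have hgm : AEMeasurable (fun y => ‖g y‖ₑ) (volume.restrict D) := hg.aestronglyMeasurable.enorm
  have hne : ∀ᵐ y ∂(volume.restrict D), x ≠ y := by
    refine ae_restrict_of_ae ?_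
    filter_upwards [compl_mem_ae_iff.2 (measure_singleton x)] with y hy h
    exact hy h.symm
  calc _ ≤ ∫⁻ t in Ioc δ 1, ∫⁻ y in D,
          ENNReal.ofReal ((t ^ 4)⁻¹ * ψ (t⁻¹ • (y - x) - p) * ‖x - y‖) * ‖g y‖ₑ := by
        refine (enorm_integral_le_lintegral_enorm _).trans (lintegral_mono fun t => ?_)
        refine (enorm_integral_le_lintegral_enorm _).trans (lintegral_mono fun y => ?_)
        rw [← ofReal_norm (g y), ← ENNReal.ofReal_mul
          (mul_nonneg (mul_nonneg (by positivity) (hψ0 _)) (norm_nonneg _)), ← ofReal_norm]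
        refine ENNReal.ofReal_le_ofReal ?_
        rw [norm_mul, norm_mul, Real.norm_of_nonneg (hψ0 _),
          Real.norm_of_nonneg (by positivity : 0 ≤ (t ^ 4)⁻¹), mul_assoc, mul_assoc,
          norm_sub_rev x y, mul_comm ‖y - x‖]
        have := hψ0 (t⁻¹ • (y - x) - p)
        gcongr
        exact norm_inner_le_norm _ _
    _ = ∫⁻ y in D, ∫⁻ t in Ioc δ 1,
          ENNReal.ofReal ((t ^ 4)⁻¹ * ψ (t⁻¹ • (y - x) - p) * ‖x - y‖) * ‖g y‖ₑ := by
        refine lintegral_lintegral_swap ?_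
        refine AEMeasurable.mul ?_ (hgm.comp_quasiMeasurePreserving
          Measure.quasiMeasurePreserving_snd)
        have : Measurable fun z : ℝ × E3 => ψ (z.1⁻¹ • (z.2 - x) - p) :=
          hψ.continuous.measurable.comp (by fun_prop)
        exact (((measurable_fst.pow_const 4).inv.mul this).mul
          (measurable_const.sub measurable_snd).norm).ennreal_ofReal.aemeasurable
    _ ≤ ∫⁻ y in D, ENNReal.ofReal (M * (‖p‖ + s) ^ 4 / (‖p‖ - s)) *
          (ENNReal.ofReal (‖x - y‖ ^ 2)⁻¹ * ‖g y‖ₑ) := by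
        refine lintegral_mono_ae ?_
        filter_upwards [hne] with y hy
        rw [lintegral_mul_const, ← mul_assoc]
        · gcongr
          exact lintegral_scaled_bump_le hs0 hs hM hψ0 hp hy hδ.1
        · have : Measurable fun t : ℝ => ψ (t⁻¹ • (y - x) - p) :=
            hψ.continuous.measurable.comp (by fun_prop)
          exact (((measurable_id.pow_const 4).inv.mul this).mul_const _).ennreal_ofReal
    _ = _ := by
        rw [lintegral_const_mul' _ _ ENNReal.ofReal_ne_top, rieszPotential]

/-! ### The Sobolev embedding under the cone condition -/

/-- At a Lebesgue point `x` of `f` (in the sense of balls of radius `t s` centred at `x + t p`) the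
averages of `f` against the normalized bumps `t⁻³ ψ((y - x) / t - p)` converge to `f x`. -/
theorem tendsto_integral_mul_scaled_bump {f : E3 → ℝ} (hf : Integrable f) {ψ : E3 → ℝ}
    (hψ : ContDiff ℝ ∞ ψ) {s M : ℝ} (hs0 : 0 < s)
    (hs : tsupport ψ ⊆ Metric.closedBall 0 s) (hM : ∀ w, ψ w ≤ M) (hψ0 : ∀ w, 0 ≤ ψ w)
    (hψ1 : ∫ w, ψ w = 1) {p x : E3}
    (hx : Tendsto (fun t : ℝ => ⨍ y in Metric.closedBall (x + t • p) (t * s), ‖f y - f x‖)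
      (𝓝[>] 0) (𝓝 0)) :
    Tendsto (fun t : ℝ => ∫ y, f y * ((t ^ 3)⁻¹ * ψ (t⁻¹ • (y - x) - p))) (𝓝[>] 0)
      (𝓝 (f x)) := by
  set v := volume.real (Metric.ball (0 : E3) 1) with hv
  rw [tendsto_iff_norm_sub_tendsto_zero]
  have hlim : Tendsto (fun t : ℝ => M * s ^ 3 * v *
      ⨍ y in Metric.closedBall (x + t • p) (t * s), ‖f y - f x‖) (𝓝[>] 0) (𝓝 0) := by
    simpa using hx.const_mul (M * s ^ 3 * v)
  refine squeeze_zero' (Eventually.of_forall fun _ => norm_nonneg _) ?_ hlim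
  filter_upwards [self_mem_nhdsWithin] with t ht
  have ht0 : 0 < t := ht
  set B := Metric.closedBall (x + t • p) (t * s) with hB
  set Φ : E3 → ℝ := fun y => (t ^ 3)⁻¹ * ψ (t⁻¹ • (y - x) - p) with hΦ
  have hΦc : Continuous Φ := continuous_const.mul (hψ.continuous.comp (by fun_prop))
  have hΦ0 : ∀ y, 0 ≤ Φ y := fun y => mul_nonneg (by positivity) (hψ0 _)
  have hΦM : ∀ y, Φ y ≤ (t ^ 3)⁻¹ * M := fun y => by
    simp only [hΦ]
    gcongr
    exact hM _
  have hΦB : ∀ y, y ∉ B → Φ y = 0 := by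
    intro y hy
    have : t⁻¹ • (y - x) - p ∉ tsupport ψ := fun h =>
      hy (mem_closedBall_of_bump_ne_zero hs ht0 h)
    simp [hΦ, image_eq_zero_of_notMem_tsupport this]
  have hΦcs : HasCompactSupport Φ :=
    HasCompactSupport.intro (isCompact_closedBall (x + t • p) (t * s)) hΦB
  have hΦi : Integrable Φ := hΦc.integrable_of_hasCompactSupport hΦcs
  have hΦ1 : ∫ y, Φ y = 1 := by
    rw [integral_const_mul, integral_sub_right_eq_self (fun y => ψ (t⁻¹ • y - p)) x,
      Measure.integral_comp_inv_smul_of_nonneg volume (fun y => ψ (y - p)) ht0.le,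
      integral_sub_right_eq_self ψ p, hψ1]
    simp [ht0.ne']
  have hfΦ : Integrable (fun y => f y * Φ y) := hf.mul_bdd (c := (t ^ 3)⁻¹ * M)
    hΦc.aestronglyMeasurable (Eventually.of_forall fun y => by
      rw [Real.norm_of_nonneg (hΦ0 y)]; exact hΦM y)
  have h1 : (∫ y, f y * Φ y) - f x = ∫ y in B, (f y - f x) * Φ y := by
    rw [setIntegral_eq_integral_of_forall_compl_eq_zero fun y hy => by rw [hΦB y hy, mul_zero]]
    simp only [sub_mul]
    rw [integral_sub hfΦ (hΦi.const_mul _), integral_const_mul, hΦ1, mul_one]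
  have hvB : volume.real B = (t * s) ^ 3 * v := by
    rw [hB, Measure.addHaar_real_closedBall _ _ (by positivity)]
    simp [hv]
  have hBfin : volume B ≠ ⊤ := (isCompact_closedBall _ _).measure_lt_top.ne
  rw [h1]
  calc ‖∫ y in B, (f y - f x) * Φ y‖ ≤ ∫ y in B, (t ^ 3)⁻¹ * M * ‖f y - f x‖ := by
        refine norm_integral_le_of_norm_le ?_ (Eventually.of_forall fun y => ?_)
        · exact ((hf.integrableOn.sub (integrableOn_const hBfin)).norm).const_mul _
        · rw [norm_mul, mul_comm, Real.norm_of_nonneg (hΦ0 y)]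
          gcongr
          exact hΦM y
    _ = M * s ^ 3 * v * ⨍ y in B, ‖f y - f x‖ := by
        have hv0 : 0 < v := by
          rw [hv]
          exact ENNReal.toReal_pos (Metric.measure_ball_pos _ _ one_pos).ne'
            measure_ball_lt_top.ne
        rw [integral_const_mul, setAverage_eq, hvB, smul_eq_mul]
        field_simp

theorem exists_smooth_bump {s : ℝ} (hs : 0 < s) :
    ∃ (ψ : E3 → ℝ) (M : ℝ), ContDiff ℝ ∞ ψ ∧ tsupport ψ ⊆ Metric.closedBall 0 s ∧
      (∀ w, ψ w ≤ M) ∧ (∀ w, 0 ≤ ψ w) ∧ ∫ w, ψ w = 1 := by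
  let φ : ContDiffBump (0 : E3) := ⟨s / 2, s, by positivity, by linarith⟩
  have hc : Continuous (φ.normed volume) := (φ.contDiff_normed (n := 0)).continuous
  obtain ⟨M, hM⟩ := hc.bounded_above_of_compact_support φ.hasCompactSupport_normed
  exact ⟨φ.normed volume, M, φ.contDiff_normed, by rw [φ.tsupport_normed_eq],
    fun w => (le_abs_self _).trans (hM w), fun w => φ.nonneg_normed w, φ.integral_normed⟩

/-- The pointwise form of the Sobolev embedding under the cone condition: a function is dominated
by the Riesz potential of itself and its weak gradient. -/
theorem exists_enorm_le_rieszPotential {D : Set E3} (hDm : MeasurableSet D)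
    (hb : Bornology.IsBounded D) (hcone : ConeCondition D) :
    ∃ C : ℝ≥0∞, C ≠ ⊤ ∧ ∀ (u : E3 → ℝ) (g : E3 → E3), MemLp u 2 (volume.restrict D) →
      MemLp g 2 (volume.restrict D) → IsWeakGradient D u g →
      ∀ᵐ x ∂(volume.restrict D),
        ‖u x‖ₑ ≤ C * rieszPotential D (fun y => ‖u y‖ₑ + ‖g y‖ₑ) x := by
  obtain ⟨ρ, κ, hρ, hκ0, hκ1, hcone⟩ := hcone
  have hfin : IsFiniteMeasure (volume.restrict D) := ⟨by simpa using hb.measure_lt_top⟩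
  -- balls of radius `t s` centred at `x + t r ξ` lie in the cone at `x` with axis `ξ`
  set r := ρ / 2 with hr
  set s := r * (1 - κ) / 4 with hs
  have hr0 : 0 < r := by positivity
  have h1κ : 0 < 1 - κ := by linarith
  have hs0 : 0 < s := by positivity
  have hsr : s < r := by rw [hs]; nlinarith
  have hballs : ∀ x ∈ D, ∃ p : E3, ‖p‖ = r ∧
      ∀ t ∈ Ioc (0 : ℝ) 1, Metric.closedBall (x + t • p) (t * s) ⊆ D := by
    intro x hx
    obtain ⟨ξ, hξ, hC⟩ := hcone x hx
    have hp : ‖r • ξ‖ = r := by rw [norm_smul, hξ, Real.norm_of_nonneg hr0.le, mul_one]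
    refine ⟨r • ξ, hp, fun t ht y hy => ?_⟩
    obtain ⟨h1, h2⟩ := norm_sub_bounds_of_mem_closedBall ht.1 hy
    rw [hp, norm_sub_rev] at h1 h2
    have h3 : y = x + (y - x) := by abel
    rw [h3]
    have ht0 := ht.1
    have ht1 := ht.2
    refine hC _ ?_ ?_
    · calc ‖y - x‖ ≤ t * (r + s) := h2
        _ ≤ 1 * (r + s) := by gcongr
        _ < ρ := by linarith
    · have h4 : inner ℝ ξ (y - x) = inner ℝ ξ (y - (x + t • r • ξ)) + t * r := by
        have : y - x = (y - (x + t • r • ξ)) + t • r • ξ := by abel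
        conv_lhs => rw [this]
        rw [inner_add_right, inner_smul_right, inner_smul_right, real_inner_self_eq_norm_sq, hξ]
        ring
      have h5 : -(t * s) ≤ inner ℝ ξ (y - (x + t • r • ξ)) := by
        have := abs_real_inner_le_norm ξ (y - (x + t • r • ξ))
        rw [hξ, one_mul] at this
        have h6 := mem_closedBall_iff_norm.1 hy
        linarith [neg_le_of_abs_le this]
      have h7 : κ * (r + s) < r - s := by rw [hs]; nlinarith
      calc κ * ‖y - x‖ ≤ κ * (t * (r + s)) := by gcongr
        _ = t * (κ * (r + s)) := by ring
        _ < t * (r - s) := by gcongr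
        _ ≤ inner ℝ ξ (y - x) := by rw [h4]; linarith
  obtain ⟨ψ, M, hψ, hψs, hM, hψ0, hψ1⟩ := exists_smooth_bump hs0
  have hM0 : 0 ≤ M := (hψ0 0).trans (hM 0)
  set C₁ := ENNReal.ofReal (M * (r + s) ^ 4 / (r - s)) with hC₁
  set C₂ := ENNReal.ofReal (M * (r + s) ^ 2) with hC₂
  refine ⟨C₁ + C₂, by simp [hC₁, hC₂], fun u g hu hg hw => ?_⟩
  have hui : Integrable u (volume.restrict D) := hu.integrable (by norm_num)
  set f := D.indicator u with hf
  have hfi : Integrable f := (integrable_indicator_iff hDm).2 hui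
  have hleb := ae_restrict_of_ae (s := D)
    (IsUnifLocDoublingMeasure.ae_tendsto_average_norm_sub volume hfi.locallyIntegrable (r / s))
  filter_upwards [hleb, ae_restrict_mem hDm] with x hx hxD
  obtain ⟨p, hp, hB⟩ := hballs x hxD
  have hfx : f x = u x := indicator_of_mem hxD u
  have hlim : Tendsto (fun t : ℝ => ∫ y in D, u y * ((t ^ 3)⁻¹ * ψ (t⁻¹ • (y - x) - p)))
      (𝓝[>] 0) (𝓝 (u x)) := by
    have h1 := tendsto_integral_mul_scaled_bump hfi hψ hs0 hψs hM hψ0 hψ1 (p := p) (x := x) ?_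
    · rw [hfx] at h1
      refine h1.congr fun t => ?_
      rw [← integral_indicator hDm]
      refine integral_congr_ae (Eventually.of_forall fun y => ?_)
      simp only [hf, indicator_mul_left]
    · refine hx (fun t : ℝ => x + t • p) (fun t => t * s) ?_ ?_
      · refine tendsto_nhdsWithin_iff.2 ⟨?_, ?_⟩
        · have : Tendsto (fun t : ℝ => t * s) (𝓝 0) (𝓝 (0 * s)) := tendsto_id.mul_const s
          rw [zero_mul] at this
          exact this.mono_left nhdsWithin_le_nhds
        · filter_upwards [self_mem_nhdsWithin] with t ht using mul_pos ht hs0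
      · filter_upwards [self_mem_nhdsWithin] with t ht
        have ht0 : 0 < t := ht
        rw [mem_closedBall_iff_norm]
        have : x - (x + t • p) = -(t • p) := by abel
        rw [this, norm_neg, norm_smul, hp, Real.norm_of_nonneg ht0.le]
        apply le_of_eq
        field_simp
  set A : ℝ → ℝ := fun t => ∫ y in D, u y * ((t ^ 3)⁻¹ * ψ (t⁻¹ • (y - x) - p)) with hA
  set V := rieszPotential D (fun y => ‖u y‖ₑ + ‖g y‖ₑ) x with hV
  have hA1 : ‖A 1‖ₑ ≤ C₂ * V := by
    refine (enorm_integral_le_lintegral_enorm _).trans ?_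
    rw [hV, rieszPotential, ← lintegral_const_mul' _ _ ENNReal.ofReal_ne_top]
    have hne : ∀ᵐ y ∂(volume.restrict D), x ≠ y := by
      refine ae_restrict_of_ae ?_
      filter_upwards [compl_mem_ae_iff.2 (measure_singleton x)] with y hy h
      exact hy h.symm
    refine lintegral_mono_ae ?_
    filter_upwards [hne] with y hy
    have hd0 : 0 < ‖x - y‖ := norm_pos_iff.2 (sub_ne_zero.2 hy)
    rw [enorm_mul, mul_comm, ← mul_assoc]
    refine mul_le_mul' ?_ le_self_add
    rw [← ENNReal.ofReal_mul (by positivity), ← ofReal_norm]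
    refine ENNReal.ofReal_le_ofReal ?_
    rw [Real.norm_of_nonneg (mul_nonneg (by norm_num) (hψ0 _))]
    by_cases h : (1 : ℝ)⁻¹ • (y - x) - p ∈ tsupport ψ
    · obtain ⟨-, h2⟩ := norm_sub_bounds_of_mem_closedBall one_pos
        (mem_closedBall_of_bump_ne_zero hψs one_pos h)
      rw [hp, one_mul] at h2
      rw [one_pow, inv_one, one_mul, mul_assoc]
      refine (hM _).trans (le_mul_of_one_le_right hM0 ?_)
      rw [← div_eq_mul_inv, one_le_div (by positivity)]
      gcongr
    · rw [image_eq_zero_of_notMem_tsupport h]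
      simp only [mul_zero]
      positivity
  have hAδ : ∀ δ ∈ Ioc (0 : ℝ) 1, ‖A δ‖ₑ ≤ (C₁ + C₂) * V := by
    intro δ hδ
    have h1 := enorm_average_sub_average_le hu hg hw hψ hs0 hψs hM hψ0 (x := x)
      (by rw [hp]; exact hsr) hB hδ
    rw [hp] at h1
    have h2 : rieszPotential D (fun y => ‖g y‖ₑ) x ≤ V :=
      lintegral_mono fun y => mul_le_mul' le_rfl le_add_self
    calc ‖A δ‖ₑ = ‖A 1 - (A 1 - A δ)‖ₑ := by rw [sub_sub_cancel]
      _ ≤ ‖A 1‖ₑ + ‖A 1 - A δ‖ₑ := enorm_sub_le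
      _ ≤ C₂ * V + C₁ * V := add_le_add hA1 (h1.trans (mul_le_mul' le_rfl h2))
      _ = (C₁ + C₂) * V := by rw [add_comm, add_mul]
  refine le_of_tendsto ((continuous_enorm.tendsto _).comp hlim) ?_
  filter_upwards [Ioc_mem_nhdsGT one_pos] with δ hδ using hAδ δ hδ

/-- The Sobolev embedding of `H¹(D)` into `L⁴(D)` for a bounded set with the cone condition. -/
theorem exists_eLpNorm_four_le {D : Set E3} (hDm : MeasurableSet D)
    (hb : Bornology.IsBounded D) (hcone : ConeCondition D) :
    ∃ C : ℝ≥0∞, C ≠ ⊤ ∧ ∀ (u : E3 → ℝ) (g : E3 → E3), MemLp u 2 (volume.restrict D) →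
      MemLp g 2 (volume.restrict D) → IsWeakGradient D u g →
      eLpNorm u 4 (volume.restrict D)
        ≤ C * (eLpNorm u 2 (volume.restrict D) + eLpNorm g 2 (volume.restrict D)) := by
  obtain ⟨C, hC, h⟩ := exists_enorm_le_rieszPotential hDm hb hcone
  obtain ⟨A, hA, hT⟩ := exists_eLpNorm_rieszPotential_four_le hDm hb
  refine ⟨C * A, ENNReal.mul_ne_top hC hA, fun u g hu hg hw => ?_⟩
  have hum := hu.aestronglyMeasurable.enorm
  have hgm := hg.aestronglyMeasurable.enorm
  calc eLpNorm u 4 (volume.restrict D)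
      ≤ C * eLpNorm (rieszPotential D fun y => ‖u y‖ₑ + ‖g y‖ₑ) 4 (volume.restrict D) := by
        refine eLpNorm_le_mul_eLpNorm_of_ae_le_mul'' 4 ?_ ?_
        · exact (AEMeasurable.lintegral_prod_right' (f := fun z : E3 × E3 =>
            ENNReal.ofReal (‖z.1 - z.2‖ ^ 2)⁻¹ * (‖u z.2‖ₑ + ‖g z.2‖ₑ))
            (measurable_rieszKernel.aemeasurable.mul ((hum.add hgm).comp_quasiMeasurePreserving
              Measure.quasiMeasurePreserving_snd))).aestronglyMeasurable
        · simpa using h u g hu hg hw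
    _ ≤ C * (A * eLpNorm (fun y => ‖u y‖ₑ + ‖g y‖ₑ) 2 (volume.restrict D)) := by
        gcongr
        exact hT _ (hum.add hgm)
    _ ≤ C * (A * (eLpNorm u 2 (volume.restrict D) + eLpNorm g 2 (volume.restrict D))) := by
        gcongr
        refine (eLpNorm_add_le hum.aestronglyMeasurable hgm.aestronglyMeasurable
          (by norm_num)).trans (le_of_eq ?_)
        rw [eLpNorm_enorm, eLpNorm_enorm]
    _ = _ := by rw [mul_assoc]

/-! ### Integration by parts against the Newtonian kernel -/

theorem hasFDerivAt_inv_sqrt_norm_sq_add {η : ℝ} (hη : 0 < η) (z : E3) :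
    HasFDerivAt (fun z : E3 => (√(‖z‖ ^ 2 + η))⁻¹)
      (-((√(‖z‖ ^ 2 + η) ^ 3)⁻¹) • innerSL ℝ z) z := by
  have h0 : 0 < ‖z‖ ^ 2 + η := by positivity
  have h1 : HasFDerivAt (fun z : E3 => ‖z‖ ^ 2 + η) (2 • innerSL ℝ z) z :=
    (hasStrictFDerivAt_norm_sq z).hasFDerivAt.add_const η
  have h2 := h1.sqrt h0.ne'
  have h3 := (hasDerivAt_inv (Real.sqrt_pos.2 h0).ne').comp_hasFDerivAt z h2
  refine h3.congr_fderiv ?_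
  ext v
  have := Real.sqrt_pos.2 h0
  simp
  field_simp

theorem integrable_inv_rpow_mul {a : ℝ} (ha : a < 3) {φ : E3 → ℝ} (hφ : Continuous φ)
    (hs : HasCompactSupport φ) : Integrable (fun z => ‖z‖ ^ (-a) * φ z) := by
  have hd : Module.finrank ℝ E3 = 3 := by simp
  have h : LocallyIntegrable (fun z : E3 => ‖z‖ ^ (-a)) := by
    refine locallyIntegrable_of_norm_le_rpow (by rw [hd]; norm_num) (α := a) (C := 1)
      (by rw [hd]; exact_mod_cast ha) (Eventually.of_forall fun x => ?_)
      (measurable_norm.pow_const _).aestronglyMeasurable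
    rw [Real.norm_of_nonneg (by positivity), one_mul]
  simpa [mul_comm] using h.integrable_smul_left_of_hasCompactSupport hφ hs

/-- Integration by parts against `1 / |z|`, by passing to the limit in the same identity for
`(|z|² + η)^{-1/2}`. -/
theorem integral_inv_norm_mul_fderiv {φ : E3 → ℝ} (hφ : ContDiff ℝ ∞ φ)
    (hs : HasCompactSupport φ) (v : E3) :
    ∫ z, ‖z‖⁻¹ * fderiv ℝ φ z v = ∫ z, φ z * ((‖z‖ ^ 3)⁻¹ * inner ℝ z v) := by
  set η : ℕ → ℝ := fun n => 1 / ((n : ℝ) + 1) with hη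
  have hη0 : ∀ n, 0 < η n := fun n => Nat.one_div_pos_of_nat
  have hηl : Tendsto η atTop (𝓝 0) := tendsto_one_div_add_atTop_nhds_zero_nat
  set q : ℕ → E3 → ℝ := fun n z => (√(‖z‖ ^ 2 + η n))⁻¹ with hq
  have hqle : ∀ n (z : E3), ‖z‖ ≤ √(‖z‖ ^ 2 + η n) := by
    intro n z
    refine Real.le_sqrt_of_sq_le ?_
    linarith [hη0 n]
  have hdc : Continuous (fun z => fderiv ℝ φ z v) :=
    (hφ.continuous_fderiv (by simp)).clm_apply continuous_const
  have hds : HasCompactSupport (fun z => fderiv ℝ φ z v) := hs.fderiv_apply (𝕜 := ℝ) v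
  have hsq : ∀ n, Continuous (fun z : E3 => √(‖z‖ ^ 2 + η n)) := fun n => by fun_prop
  have hsqpos : ∀ n (z : E3), 0 < √(‖z‖ ^ 2 + η n) := fun n z =>
    Real.sqrt_pos.2 (by have := hη0 n; positivity)
  have hqc : ∀ n, Continuous (q n) := fun n => (hsq n).inv₀ fun z => (hsqpos n z).ne'
  have hrc : ∀ n, Continuous fun z : E3 => (√(‖z‖ ^ 2 + η n) ^ 3)⁻¹ * inner ℝ z v := fun n =>
    (((hsq n).pow 3).inv₀ fun z => (pow_pos (hsqpos n z) 3).ne').mul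
      (continuous_id.inner continuous_const)
  have hparts : ∀ n, ∫ z, q n z * fderiv ℝ φ z v
      = ∫ z, φ z * ((√(‖z‖ ^ 2 + η n) ^ 3)⁻¹ * inner ℝ z v) := by
    intro n
    have hfd : ∀ z, fderiv ℝ (q n) z v = -((√(‖z‖ ^ 2 + η n) ^ 3)⁻¹ * inner ℝ z v) := by
      intro z
      rw [(hasFDerivAt_inv_sqrt_norm_sq_add (hη0 n) z).fderiv]
      simp
    rw [integral_mul_fderiv_eq_neg_fderiv_mul_of_integrable]
    · rw [← integral_neg]
      refine integral_congr_ae (Eventually.of_forall fun z => ?_)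
      simp only [hfd]
      ring
    · simp only [hfd]
      exact ((hrc n).neg.mul hφ.continuous).integrable_of_hasCompactSupport hs.mul_left
    · exact ((hqc n).mul hdc).integrable_of_hasCompactSupport hds.mul_left
    · exact ((hqc n).mul hφ.continuous).integrable_of_hasCompactSupport hs.mul_left
    · exact fun z _ => (hasFDerivAt_inv_sqrt_norm_sq_add (hη0 n) z).differentiableAt
    · exact fun z _ => hφ.differentiable (by simp) z
  have hsql : ∀ z : E3, Tendsto (fun n => √(‖z‖ ^ 2 + η n)) atTop (𝓝 ‖z‖) := by
    intro z
    have : Tendsto (fun n => √(‖z‖ ^ 2 + η n)) atTop (𝓝 √(‖z‖ ^ 2 + 0)) :=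
      (Real.continuous_sqrt.tendsto _).comp (hηl.const_add _)
    rwa [add_zero, Real.sqrt_sq (norm_nonneg z)] at this
  have hne : ∀ᵐ z : E3, z ≠ 0 := compl_mem_ae_iff.2 (measure_singleton 0)
  have hL : Tendsto (fun n => ∫ z, q n z * fderiv ℝ φ z v) atTop
      (𝓝 (∫ z, ‖z‖⁻¹ * fderiv ℝ φ z v)) := by
    refine tendsto_integral_of_dominated_convergence
      (fun z => ‖‖z‖ ^ (-1 : ℝ) * fderiv ℝ φ z v‖)
      (fun n => ((hqc n).mul hdc).aestronglyMeasurable)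
      (integrable_inv_rpow_mul (by norm_num) hdc hds).norm (fun n => ?_) ?_
    · filter_upwards [hne] with z hz
      have hz0 : 0 < ‖z‖ := norm_pos_iff.2 hz
      rw [norm_mul, norm_mul, Real.rpow_neg_one, norm_inv, norm_inv, norm_norm,
        Real.norm_of_nonneg (Real.sqrt_nonneg _)]
      gcongr
      exact hqle n z
    · filter_upwards [hne] with z hz
      exact ((hsql z).inv₀ (norm_ne_zero_iff.2 hz)).mul_const _
  have hR : Tendsto (fun n => ∫ z, φ z * ((√(‖z‖ ^ 2 + η n) ^ 3)⁻¹ * inner ℝ z v)) atTop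
      (𝓝 (∫ z, φ z * ((‖z‖ ^ 3)⁻¹ * inner ℝ z v))) := by
    refine tendsto_integral_of_dominated_convergence
      (fun z => ‖v‖ * ‖‖z‖ ^ (-2 : ℝ) * φ z‖)
      (fun n => (hφ.continuous.mul (hrc n)).aestronglyMeasurable)
      ((integrable_inv_rpow_mul (by norm_num) hφ.continuous hs).norm.const_mul _) (fun n => ?_) ?_
    · filter_upwards [hne] with z hz
      have hz0 : 0 < ‖z‖ := norm_pos_iff.2 hz
      rw [norm_mul, norm_mul, norm_mul, Real.norm_of_nonneg (by positivity : 0 ≤ ‖z‖ ^ (-2 : ℝ)),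
        norm_inv, norm_pow, Real.norm_of_nonneg (Real.sqrt_nonneg _), Real.rpow_neg hz0.le]
      calc ‖φ z‖ * ((√(‖z‖ ^ 2 + η n) ^ 3)⁻¹ * ‖inner ℝ z v‖)
          ≤ ‖φ z‖ * ((‖z‖ ^ 3)⁻¹ * (‖z‖ * ‖v‖)) := by
            gcongr
            · exact hqle n z
            · exact norm_inner_le_norm z v
        _ = ‖v‖ * ((‖z‖ ^ (2 : ℝ))⁻¹ * ‖φ z‖) := by
            rw [Real.rpow_two]
            field_simp
    · filter_upwards [hne] with z hz
      have h3 := ((hsql z).pow 3).inv₀ (pow_ne_zero 3 (norm_ne_zero_iff.2 hz))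
      exact (h3.mul_const _).const_mul _
  exact tendsto_nhds_unique hL ((tendsto_congr hparts).2 hR)

theorem integral_newtonKernel_mul_fderiv {φ : E3 → ℝ} (hφ : ContDiff ℝ ∞ φ)
    (hs : HasCompactSupport φ) (v s : E3) :
    ∫ x, newtonKernel x s * fderiv ℝ φ x v
      = ∫ x, φ x * ((4 * Real.pi * ‖x - s‖ ^ 3)⁻¹ * inner ℝ (x - s) v) := by
  have h := integral_inv_norm_mul_fderiv (φ := fun z => φ (z + s)) (hφ.comp (by fun_prop))
    (hs.comp_homeomorph (Homeomorph.addRight s)) v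
  rw [← integral_add_right_eq_self _ s,
    ← integral_add_right_eq_self (fun x => φ x * _) s]
  have e1 : ∀ z, newtonKernel (z + s) s * fderiv ℝ φ (z + s) v
      = (4 * Real.pi)⁻¹ * (‖z‖⁻¹ * fderiv ℝ (fun z => φ (z + s)) z v) := by
    intro z
    rw [fderiv_comp_add_right, newtonKernel, add_sub_cancel_right, one_div, mul_inv, mul_assoc]
  have e2 : ∀ z, φ (z + s) * ((4 * Real.pi * ‖z + s - s‖ ^ 3)⁻¹ * inner ℝ (z + s - s) v)
      = (4 * Real.pi)⁻¹ * (φ (z + s) * ((‖z‖ ^ 3)⁻¹ * inner ℝ z v)) := by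
    intro z
    rw [add_sub_cancel_right, mul_inv]
    ring
  simp only [e1, e2, integral_const_mul, h]

/-! ### The Newtonian potential as a map into `H¹(D)` -/

theorem measurable_newtonKernel : Measurable (Function.uncurry newtonKernel) := by
  unfold Function.uncurry newtonKernel
  fun_prop

theorem exists_newtonKernel_le {D : Set E3} (hb : Bornology.IsBounded D) :
    ∃ R : ℝ, 0 ≤ R ∧ ∀ x ∈ D, ∀ s ∈ D, ‖newtonKernel x s‖ ≤ R * (‖x - s‖ ^ 2)⁻¹ := by
  obtain ⟨R, hR⟩ := hb.subset_ball 0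
  refine ⟨2 * |R|, by positivity, fun x hx s hs => ?_⟩
  have h1 := mem_ball_zero_iff.1 (hR hx)
  have h2 := mem_ball_zero_iff.1 (hR hs)
  have h3 := norm_sub_le x s
  have h5 : ‖x - s‖ ≤ 2 * |R| := by linarith [le_abs_self R]
  have hpi : 1 ≤ 4 * Real.pi := by linarith [Real.pi_gt_three]
  rcases eq_or_ne x s with rfl | hne
  · simp [newtonKernel]
  have h0 : 0 < ‖x - s‖ := norm_pos_iff.2 (sub_ne_zero.2 hne)
  rw [newtonKernel, Real.norm_of_nonneg (by positivity), ← div_eq_mul_inv,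
    div_le_div_iff₀ (by positivity) (by positivity)]
  have h6 : ‖x - s‖ * ‖x - s‖ ≤ (2 * |R|) * (4 * Real.pi * ‖x - s‖) := by
    gcongr
    exact le_mul_of_one_le_left h0.le hpi
  linarith [h6, sq ‖x - s‖]

/-- The gradient in `x` of `newtonKernel x s`; on the diagonal its value is `0`. -/
noncomputable def newtonKernelGrad (x s : E3) : E3 := -((4 * Real.pi * ‖x - s‖ ^ 3)⁻¹ • (x - s))

theorem measurable_newtonKernelGrad : Measurable (Function.uncurry newtonKernelGrad) := by
  unfold Function.uncurry newtonKernelGrad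
  fun_prop

theorem norm_newtonKernelGrad_le (x s : E3) : ‖newtonKernelGrad x s‖ ≤ (‖x - s‖ ^ 2)⁻¹ := by
  have hpi : 1 ≤ 4 * Real.pi := by linarith [Real.pi_gt_three]
  rcases eq_or_ne x s with rfl | hne
  · simp [newtonKernelGrad]
  have h0 : 0 < ‖x - s‖ := norm_pos_iff.2 (sub_ne_zero.2 hne)
  rw [newtonKernelGrad, norm_neg, norm_smul, norm_inv, Real.norm_of_nonneg (by positivity)]
  calc (4 * Real.pi * ‖x - s‖ ^ 3)⁻¹ * ‖x - s‖ = (4 * Real.pi)⁻¹ * (‖x - s‖ ^ 2)⁻¹ := by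
        field_simp
    _ ≤ 1 * (‖x - s‖ ^ 2)⁻¹ := by
        gcongr
        exact inv_le_one_of_one_le₀ hpi
    _ = _ := one_mul _

/-- The Newtonian potential of `f` over `D`. -/
noncomputable def newtonPotential (D : Set E3) (f : E3 → ℝ) (x : E3) : ℝ :=
  ∫ s in D, newtonKernel x s * f s

/-- The gradient of the Newtonian potential of `f` over `D`, differentiated under the integral. -/
noncomputable def newtonPotentialGrad (D : Set E3) (f : E3 → ℝ) (x : E3) : E3 :=
  ∫ s in D, f s • newtonKernelGrad x s

section Potential

variable {D : Set E3} {f : E3 → ℝ}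

theorem lintegral_enorm_newtonKernel_mul_le (hDm : MeasurableSet D) {R : ℝ} (hR0 : 0 ≤ R)
    (hR : ∀ x ∈ D, ∀ s ∈ D, ‖newtonKernel x s‖ ≤ R * (‖x - s‖ ^ 2)⁻¹) (f : E3 → ℝ) {x : E3}
    (hx : x ∈ D) :
    ∫⁻ s in D, ‖newtonKernel x s * f s‖ₑ
      ≤ ENNReal.ofReal R * rieszPotential D (fun s => ‖f s‖ₑ) x := by
  rw [rieszPotential, ← lintegral_const_mul' _ _ ENNReal.ofReal_ne_top]
  refine setLIntegral_mono' hDm fun s hs => ?_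
  rw [enorm_mul, ← mul_assoc, ← ENNReal.ofReal_mul hR0, ← ofReal_norm (newtonKernel x s)]
  gcongr
  exact hR x hx s hs

theorem lintegral_enorm_newtonKernelGrad_le (f : E3 → ℝ) (x : E3) :
    ∫⁻ s in D, ‖f s • newtonKernelGrad x s‖ₑ ≤ rieszPotential D (fun s => ‖f s‖ₑ) x := by
  refine lintegral_mono fun s => ?_
  rw [enorm_smul, mul_comm, ← ofReal_norm (newtonKernelGrad x s)]
  gcongr
  exact norm_newtonKernelGrad_le x s

theorem aestronglyMeasurable_newtonKernel_mul (hf : AEStronglyMeasurable f (volume.restrict D)) :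
    AEStronglyMeasurable (fun z : E3 × E3 => newtonKernel z.1 z.2 * f z.2)
      ((volume.restrict D).prod (volume.restrict D)) :=
  measurable_newtonKernel.aestronglyMeasurable.mul (hf.comp_quasiMeasurePreserving
    Measure.quasiMeasurePreserving_snd)

theorem aestronglyMeasurable_smul_newtonKernelGrad
    (hf : AEStronglyMeasurable f (volume.restrict D)) :
    AEStronglyMeasurable (fun z : E3 × E3 => f z.2 • newtonKernelGrad z.1 z.2)
      ((volume.restrict D).prod (volume.restrict D)) :=
  (hf.comp_quasiMeasurePreserving Measure.quasiMeasurePreserving_snd).smul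
    measurable_newtonKernelGrad.aestronglyMeasurable

theorem aestronglyMeasurable_rieszPotential (hf : AEStronglyMeasurable f (volume.restrict D)) :
    AEStronglyMeasurable (rieszPotential D fun s => ‖f s‖ₑ) (volume.restrict D) :=
  (AEMeasurable.lintegral_prod_right' (f := fun z : E3 × E3 =>
    ENNReal.ofReal (‖z.1 - z.2‖ ^ 2)⁻¹ * ‖f z.2‖ₑ)
    (measurable_rieszKernel.aemeasurable.mul (hf.enorm.comp_quasiMeasurePreserving
      Measure.quasiMeasurePreserving_snd))).aestronglyMeasurable

/-- Integrability on the product for kernels dominated by `|x - s|⁻²`, multiplied by a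
bounded function of the outer variable. -/
theorem integrable_prod_of_lintegral_le [IsFiniteMeasure (volume.restrict D)]
    (hV : MemLp (rieszPotential D fun s => ‖f s‖ₑ) 2 (volume.restrict D)) {ψ : E3 → ℝ}
    (hψ : Continuous ψ) (hψs : HasCompactSupport ψ) {k : E3 → E3 → ℝ}
    (hk : AEStronglyMeasurable (Function.uncurry k)
      ((volume.restrict D).prod (volume.restrict D))) {c : ℝ≥0∞} (hc : c ≠ ⊤)
    (hkle : ∀ᵐ x ∂(volume.restrict D),
      ∫⁻ s in D, ‖k x s‖ₑ ≤ c * rieszPotential D (fun s => ‖f s‖ₑ) x) :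
    Integrable (fun z : E3 × E3 => ψ z.1 * k z.1 z.2)
      ((volume.restrict D).prod (volume.restrict D)) := by
  obtain ⟨B, hB⟩ := hψ.bounded_above_of_compact_support hψs
  have hm : AEStronglyMeasurable (fun z : E3 × E3 => ψ z.1 * k z.1 z.2)
      ((volume.restrict D).prod (volume.restrict D)) :=
    (hψ.comp continuous_fst).aestronglyMeasurable.mul hk
  refine ⟨hm, ?_⟩
  rw [hasFiniteIntegral_iff_enorm, lintegral_prod _ hm.enorm]
  have hV1 : ∫⁻ x in D, rieszPotential D (fun s => ‖f s‖ₑ) x < ⊤ := by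
    have := (hV.mono_exponent (p := 1) (by norm_num)).eLpNorm_lt_top
    simpa [eLpNorm_one_eq_lintegral_enorm] using this
  calc ∫⁻ x in D, ∫⁻ s in D, ‖ψ x * k x s‖ₑ
      ≤ ∫⁻ x in D, (ENNReal.ofReal B * c) * rieszPotential D (fun s => ‖f s‖ₑ) x := by
        refine lintegral_mono_ae ?_
        filter_upwards [hkle] with x hx
        simp only [enorm_mul]
        rw [lintegral_const_mul' _ _ enorm_ne_top, mul_assoc]
        refine mul_le_mul' ?_ hx
        rw [← ofReal_norm]
        exact ENNReal.ofReal_le_ofReal (hB x)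
    _ = (ENNReal.ofReal B * c) * ∫⁻ x in D, rieszPotential D (fun s => ‖f s‖ₑ) x :=
        lintegral_const_mul' _ _ (ENNReal.mul_ne_top ENNReal.ofReal_ne_top hc)
    _ < ⊤ := ENNReal.mul_lt_top (ENNReal.mul_lt_top ENNReal.ofReal_lt_top hc.lt_top) hV1

theorem isWeakGradient_newtonPotential (hDm : MeasurableSet D) (hb : Bornology.IsBounded D)
    (hf : AEStronglyMeasurable f (volume.restrict D))
    (hV : MemLp (rieszPotential D fun s => ‖f s‖ₑ) 2 (volume.restrict D)) :
    IsWeakGradient D (newtonPotential D f) (newtonPotentialGrad D f) := by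
  intro φ h1 h2 h3 v
  have hfin : IsFiniteMeasure (volume.restrict D) := ⟨by simpa using hb.measure_lt_top⟩
  obtain ⟨R, hR0, hR⟩ := exists_newtonKernel_le hb
  have hVfin : ∀ᵐ x ∂(volume.restrict D), rieszPotential D (fun s => ‖f s‖ₑ) x < ⊤ := by
    have := (hV.mono_exponent (p := 1) (by norm_num)).eLpNorm_lt_top
    refine ae_lt_top' (aestronglyMeasurable_rieszPotential hf).aemeasurable ?_
    simpa [eLpNorm_one_eq_lintegral_enorm] using this.ne
  have hi1 := integrable_prod_of_lintegral_le hV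
    (ψ := fun x => fderiv ℝ φ x v) ((h1.continuous_fderiv (by simp)).clm_apply continuous_const)
    (h2.fderiv_apply (𝕜 := ℝ) v) (k := fun x s => newtonKernel x s * f s)
    (aestronglyMeasurable_newtonKernel_mul hf) ENNReal.ofReal_ne_top
    (by filter_upwards [ae_restrict_mem hDm] with x hx
        exact lintegral_enorm_newtonKernel_mul_le hDm hR0 hR f hx)
  have hi2 := integrable_prod_of_lintegral_le hV (ψ := φ) h1.continuous h2
    (k := fun x s => inner ℝ (f s • newtonKernelGrad x s) v)
    ((aestronglyMeasurable_smul_newtonKernelGrad hf).inner_const) (c := ‖v‖ₑ) enorm_ne_top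
    (by refine Eventually.of_forall fun x => ?_
        refine le_trans ?_ (mul_le_mul' le_rfl (lintegral_enorm_newtonKernelGrad_le f x))
        rw [← lintegral_const_mul' _ _ enorm_ne_top]
        refine lintegral_mono fun s => ?_
        rw [← ofReal_norm, ← ofReal_norm, ← ofReal_norm, ← ENNReal.ofReal_mul (norm_nonneg _)]
        refine ENNReal.ofReal_le_ofReal ?_
        rw [mul_comm]
        exact norm_inner_le_norm _ _)
  have hφD : ∀ x, x ∉ D → φ x = 0 := fun x hx => image_eq_zero_of_notMem_tsupport fun h => hx (h3 h)
  have hφD' : ∀ x, x ∉ D → fderiv ℝ φ x v = 0 := by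
    intro x hx
    have : fderiv ℝ φ x = 0 := by
      by_contra h
      exact hx (h3 (support_fderiv_subset ℝ h))
    simp [this]
  have key : ∀ s, ∫ x in D, newtonKernel x s * fderiv ℝ φ x v
      = -∫ x in D, φ x * inner ℝ (newtonKernelGrad x s) v := by
    intro s
    rw [setIntegral_eq_integral_of_forall_compl_eq_zero fun x hx => by rw [hφD' x hx, mul_zero],
      setIntegral_eq_integral_of_forall_compl_eq_zero fun x hx => by rw [hφD x hx, zero_mul],
      integral_newtonKernel_mul_fderiv h1 h2, ← integral_neg]
    refine integral_congr_ae (Eventually.of_forall fun x => ?_)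
    simp only [newtonKernelGrad, inner_neg_left, real_inner_smul_left]
    ring
  calc ∫ x in D, newtonPotential D f x * fderiv ℝ φ x v
      = ∫ x in D, ∫ s in D, fderiv ℝ φ x v * (newtonKernel x s * f s) := by
        refine integral_congr_ae (Eventually.of_forall fun x => ?_)
        simp only
        rw [integral_const_mul, newtonPotential, mul_comm]
    _ = ∫ s in D, ∫ x in D, fderiv ℝ φ x v * (newtonKernel x s * f s) := integral_integral_swap hi1
    _ = ∫ s in D, -∫ x in D, φ x * inner ℝ (f s • newtonKernelGrad x s) v := by
        refine integral_congr_ae (Eventually.of_forall fun s => ?_)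
        simp only
        have e1 : ∀ x, fderiv ℝ φ x v * (newtonKernel x s * f s)
            = f s * (newtonKernel x s * fderiv ℝ φ x v) := fun x => by ring
        have e2 : ∀ x, φ x * inner ℝ (f s • newtonKernelGrad x s) v
            = f s * (φ x * inner ℝ (newtonKernelGrad x s) v) := fun x => by
          rw [real_inner_smul_left]; ring
        simp only [e1, e2, integral_const_mul, key, mul_neg]
    _ = -∫ x in D, ∫ s in D, φ x * inner ℝ (f s • newtonKernelGrad x s) v := by
        rw [integral_neg]
        exact congrArg _ (integral_integral_swap hi2).symm
    _ = -∫ x in D, φ x * inner ℝ (newtonPotentialGrad D f x) v := by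
        congr 1
        refine integral_congr_ae ?_
        filter_upwards [hVfin] with x hx
        have hgi : Integrable (fun s => f s • newtonKernelGrad x s) (volume.restrict D) := by
          refine ⟨hf.smul (measurable_newtonKernelGrad.comp
            measurable_prodMk_left).aestronglyMeasurable, ?_⟩
          exact (lintegral_enorm_newtonKernelGrad_le f x).trans_lt hx
        rw [integral_const_mul]
        congr 1
        have := integral_inner (𝕜 := ℝ) hgi v
        simp only [real_inner_comm] at this ⊢
        simpa only [real_inner_comm, newtonPotentialGrad] using this

end Potential

theorem memLp_newtonPotential {D : Set E3} (hDm : MeasurableSet D) (hb : Bornology.IsBounded D) :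
    ∃ C : ℝ≥0∞, C ≠ ⊤ ∧ ∀ f : E3 → ℝ, MemLp f (4 / 3) (volume.restrict D) →
      MemLp (rieszPotential D fun s => ‖f s‖ₑ) 2 (volume.restrict D) ∧
      MemLp (newtonPotential D f) 2 (volume.restrict D) ∧
      MemLp (newtonPotentialGrad D f) 2 (volume.restrict D) ∧
      eLpNorm (newtonPotential D f) 2 (volume.restrict D)
        ≤ C * eLpNorm f (4 / 3) (volume.restrict D) ∧
      eLpNorm (newtonPotentialGrad D f) 2 (volume.restrict D)
        ≤ C * eLpNorm f (4 / 3) (volume.restrict D) := by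
  obtain ⟨R, hR0, hR⟩ := exists_newtonKernel_le hb
  obtain ⟨A, hA, hT⟩ := exists_eLpNorm_rieszPotential_two_le hDm hb
  refine ⟨ENNReal.ofReal R * A + A, by simp [ENNReal.mul_eq_top, hA], fun f hf => ?_⟩
  have hfm := hf.aestronglyMeasurable
  have hVm := aestronglyMeasurable_rieszPotential hfm
  have hVle := hT _ hfm.enorm
  rw [eLpNorm_enorm] at hVle
  have h1 : eLpNorm (newtonPotential D f) 2 (volume.restrict D)
      ≤ ENNReal.ofReal R * eLpNorm (rieszPotential D fun s => ‖f s‖ₑ) 2 (volume.restrict D) := by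
    refine eLpNorm_le_mul_eLpNorm_of_ae_le_mul'' 2 hVm ?_
    filter_upwards [ae_restrict_mem hDm] with x hx
    exact (enorm_integral_le_lintegral_enorm _).trans
      (lintegral_enorm_newtonKernel_mul_le hDm hR0 hR f hx)
  have h2 : eLpNorm (newtonPotentialGrad D f) 2 (volume.restrict D)
      ≤ eLpNorm (rieszPotential D fun s => ‖f s‖ₑ) 2 (volume.restrict D) := by
    refine eLpNorm_mono_enorm_ae (Eventually.of_forall fun x => ?_)
    exact (enorm_integral_le_lintegral_enorm _).trans (lintegral_enorm_newtonKernelGrad_le f x)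
  have hfin := hf.eLpNorm_lt_top
  have h1' : eLpNorm (newtonPotential D f) 2 (volume.restrict D)
      ≤ (ENNReal.ofReal R * A + A) * eLpNorm f (4 / 3) (volume.restrict D) := by
    refine h1.trans ((mul_le_mul' le_rfl hVle).trans ?_)
    rw [← mul_assoc]
    exact mul_le_mul' le_self_add le_rfl
  have h2' : eLpNorm (newtonPotentialGrad D f) 2 (volume.restrict D)
      ≤ (ENNReal.ofReal R * A + A) * eLpNorm f (4 / 3) (volume.restrict D) :=
    h2.trans (hVle.trans (mul_le_mul' le_add_self le_rfl))
  have hlt : (ENNReal.ofReal R * A + A) * eLpNorm f (4 / 3) (volume.restrict D) < ⊤ :=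
    ENNReal.mul_lt_top (by simp [ENNReal.mul_lt_top_iff, hA.lt_top]) hfin
  exact ⟨⟨hVm, hVle.trans_lt (ENNReal.mul_lt_top hA.lt_top hfin)⟩,
    ⟨(aestronglyMeasurable_newtonKernel_mul hfm).integral_prod_right', h1'.trans_lt hlt⟩,
    ⟨(aestronglyMeasurable_smul_newtonKernelGrad hfm).integral_prod_right', h2'.trans_lt hlt⟩,
    h1', h2'⟩

/-- The Newtonian potential maps `L^{4/3}(D)` boundedly into `H¹(D)`. -/
theorem exists_newtonPotential_mem_H1 {D : Set E3} (hDm : MeasurableSet D)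
    (hb : Bornology.IsBounded D) :
    ∃ C : ℝ, 0 ≤ C ∧ ∀ f : E3 → ℝ, MemLp f (4 / 3) (volume.restrict D) →
      (∀ᵐ x ∂(volume.restrict D), IntegrableOn (fun s => newtonKernel x s * f s) D) ∧
      ∃ w : H1 D, valueOf w =ᵐ[volume.restrict D] newtonPotential D f ∧
        ‖w‖ ≤ C * (eLpNorm f (4 / 3) (volume.restrict D)).toReal := by
  obtain ⟨C, hC, h⟩ := memLp_newtonPotential hDm hb
  obtain ⟨R, hR0, hR⟩ := exists_newtonKernel_le hb
  have hfin : IsFiniteMeasure (volume.restrict D) := ⟨by simpa using hb.measure_lt_top⟩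
  refine ⟨2 * C.toReal, by positivity, fun f hf => ?_⟩
  obtain ⟨hV, hN, hG, hN', hG'⟩ := h f hf
  have hfm := hf.aestronglyMeasurable
  refine ⟨?_, ?_⟩
  · have hVfin : ∀ᵐ x ∂(volume.restrict D), rieszPotential D (fun s => ‖f s‖ₑ) x < ⊤ := by
      have := (hV.mono_exponent (p := 1) (by norm_num)).eLpNorm_lt_top
      refine ae_lt_top' (aestronglyMeasurable_rieszPotential hfm).aemeasurable ?_
      simpa [eLpNorm_one_eq_lintegral_enorm] using this.ne
    filter_upwards [hVfin, ae_restrict_mem hDm] with x hx hxD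
    refine ⟨(measurable_newtonKernel.comp measurable_prodMk_left).aestronglyMeasurable.mul hfm, ?_⟩
    exact (lintegral_enorm_newtonKernel_mul_le hDm hR0 hR f hxD).trans_lt
      (ENNReal.mul_lt_top ENNReal.ofReal_lt_top hx)
  · have hw : IsWeakGradient D (hN.toLp _) (hG.toLp _) := by
      intro φ h1 h2 h3 v
      have h4 := isWeakGradient_newtonPotential hDm hb hfm hV φ h1 h2 h3 v
      rw [integral_congr_ae (g := fun x => newtonPotential D f x * fderiv ℝ φ x v), h4]
      · congr 1
        refine integral_congr_ae ?_
        filter_upwards [hG.coeFn_toLp] with x hx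
        rw [hx]
      · filter_upwards [hN.coeFn_toLp] with x hx
        rw [hx]
    refine ⟨⟨WithLp.toLp 2 (hN.toLp _, hG.toLp _), hw⟩, hN.coeFn_toLp, ?_⟩
    have e1 : ‖hN.toLp _‖ ≤ C.toReal * (eLpNorm f (4 / 3) (volume.restrict D)).toReal := by
      rw [Lp.norm_toLp, ← ENNReal.toReal_mul]
      exact ENNReal.toReal_mono (ENNReal.mul_ne_top hC hf.eLpNorm_ne_top) hN'
    have e2 : ‖hG.toLp _‖ ≤ C.toReal * (eLpNorm f (4 / 3) (volume.restrict D)).toReal := by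
      rw [Lp.norm_toLp, ← ENNReal.toReal_mul]
      exact ENNReal.toReal_mono (ENNReal.mul_ne_top hC hf.eLpNorm_ne_top) hG'
    rw [Submodule.coe_norm, WithLp.prod_norm_eq_of_L2]
    refine (Real.sqrt_le_sqrt (?_ : _ ≤ (‖hN.toLp _‖ + ‖hG.toLp _‖) ^ 2)).trans ?_
    · change ‖hN.toLp _‖ ^ 2 + ‖hG.toLp _‖ ^ 2 ≤ _
      nlinarith [norm_nonneg (hN.toLp _), norm_nonneg (hG.toLp _)]
    · rw [Real.sqrt_sq (by positivity)]
      linarith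

/-! ### Positivity of the Newtonian potential -/

/-- The self-convolution of `|z|⁻²` on `ℝ³`. -/
noncomputable def invSqConvolution (p : E3) : ℝ :=
  ∫ z : E3, (‖z‖ ^ 2)⁻¹ * (‖p - z‖ ^ 2)⁻¹

theorem integrable_inv_sq_mul_inv_max_sq {c : ℝ} (hc : 0 < c) :
    Integrable (fun z : E3 => (‖z‖ ^ 2)⁻¹ * (max ‖z‖ c ^ 2)⁻¹) := by
  have hd : Module.finrank ℝ E3 = 3 := by simp
  refine (integrable_fun_norm_addHaar volume
    (f := fun y : ℝ => (y ^ 2)⁻¹ * (max y c ^ 2)⁻¹)).2 ?_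
  have h1 : IntegrableOn (fun y : ℝ => (1 + (c ^ 2)⁻¹) * (1 + y ^ 2)⁻¹) (Ioi 0) :=
    (integrable_inv_one_add_sq.const_mul _).integrableOn
  refine Integrable.mono' h1 (by fun_prop) ?_
  filter_upwards [ae_restrict_mem measurableSet_Ioi] with y hy
  have hy0 : 0 < y := hy
  have hm : 0 < max y c := lt_max_of_lt_left hy0
  rw [hd, smul_eq_mul, Real.norm_of_nonneg (by positivity)]
  have e : y ^ (3 - 1) * ((y ^ 2)⁻¹ * (max y c ^ 2)⁻¹) = (max y c ^ 2)⁻¹ := by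
    field_simp
  rw [e, ← div_eq_mul_inv, ← one_div, div_le_div_iff₀ (by positivity) (by positivity)]
  have h2 : y ^ 2 ≤ max y c ^ 2 := by gcongr; exact le_max_left _ _
  have h3 : c ^ 2 ≤ max y c ^ 2 := by gcongr; exact le_max_right _ _
  have h4 : (c ^ 2)⁻¹ * c ^ 2 = 1 := inv_mul_cancel₀ (by positivity)
  have h5 : (c ^ 2)⁻¹ * c ^ 2 ≤ (c ^ 2)⁻¹ * max y c ^ 2 := by gcongr
  linarith

theorem integrable_inv_sq_mul_inv_sq {p : E3} (hp : p ≠ 0) :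
    Integrable (fun z : E3 => (‖z‖ ^ 2)⁻¹ * (‖p - z‖ ^ 2)⁻¹) := by
  have hd : 0 < ‖p‖ / 2 := half_pos (norm_pos_iff.2 hp)
  have hF := integrable_inv_sq_mul_inv_max_sq hd
  refine Integrable.mono' (hF.add (hF.comp_sub_left p)) (by fun_prop) ?_
  -- the larger of the two distances `|z|`, `|p - z|` is at least `|p| / 2`
  have aux : ∀ a b : ℝ, 0 ≤ a → a ≤ b → ‖p‖ ≤ a + b →
      (a ^ 2)⁻¹ * (b ^ 2)⁻¹ ≤ (a ^ 2)⁻¹ * (max a (‖p‖ / 2) ^ 2)⁻¹ := by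
    intro a b ha hab hpab
    have : 0 < max a (‖p‖ / 2) := lt_max_of_lt_right hd
    gcongr
    exact max_le hab (by linarith)
  refine Eventually.of_forall fun z => ?_
  have htri : ‖p‖ ≤ ‖z‖ + ‖p - z‖ := by
    have := norm_add_le z (p - z)
    rwa [add_sub_cancel] at this
  rw [Real.norm_of_nonneg (by positivity), Pi.add_apply]
  rcases le_total ‖z‖ ‖p - z‖ with h | h
  · refine (aux _ _ (norm_nonneg _) h htri).trans (le_add_of_nonneg_right (by positivity))
  · rw [mul_comm]
    refine (aux _ _ (norm_nonneg _) h (by linarith)).trans (le_add_of_nonneg_left (by positivity))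

theorem invSqConvolution_smul {t : ℝ} (ht : 0 < t) (p : E3) :
    invSqConvolution (t • p) = t⁻¹ * invSqConvolution p := by
  have h := Measure.integral_comp_smul volume
    (fun z : E3 => (‖z‖ ^ 2)⁻¹ * (‖t • p - z‖ ^ 2)⁻¹) t
  have hd : Module.finrank ℝ E3 = 3 := by simp
  have e : ∀ z : E3, (‖t • z‖ ^ 2)⁻¹ * (‖t • p - t • z‖ ^ 2)⁻¹
      = (t ^ 4)⁻¹ * ((‖z‖ ^ 2)⁻¹ * (‖p - z‖ ^ 2)⁻¹) := by
    intro z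
    rw [← smul_sub, norm_smul, norm_smul, Real.norm_of_nonneg ht.le]
    simp only [mul_pow, mul_inv]
    ring
  simp only [e, integral_const_mul, hd, smul_eq_mul] at h
  rw [abs_of_pos (by positivity)] at h
  unfold invSqConvolution
  field_simp at h ⊢
  linarith

theorem invSqConvolution_eq_of_norm_eq {p q : E3} (h : ‖p‖ = ‖q‖) :
    invSqConvolution p = invSqConvolution q := by
  set T := (ℝ ∙ (p - q))ᗮ.reflection with hT
  have hTp : T p = q := Submodule.reflection_sub h
  unfold invSqConvolution
  rw [← T.measurePreserving.integral_comp T.toHomeomorph.measurableEmbedding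
    (fun z : E3 => (‖z‖ ^ 2)⁻¹ * (‖q - z‖ ^ 2)⁻¹)]
  refine integral_congr_ae (Eventually.of_forall fun z => ?_)
  simp only
  rw [← hTp, ← map_sub, T.norm_map, T.norm_map]

/-- The composition formula for Riesz kernels: `|·|⁻² * |·|⁻² = c |·|⁻¹` on `ℝ³`, by invariance of
Lebesgue measure under rotations and its scaling under dilations. -/
theorem exists_invSqConvolution_eq : ∃ c : ℝ, 0 < c ∧ ∀ p : E3, p ≠ 0 →
    invSqConvolution p = c * ‖p‖⁻¹ := by
  set e : E3 := EuclideanSpace.single 0 1 with he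
  have hne : ‖e‖ = 1 := by simp [he]
  have he0 : e ≠ 0 := by
    intro h
    simp [h] at hne
  refine ⟨invSqConvolution e, ?_, fun p hp => ?_⟩
  · have hnn : 0 ≤ fun z : E3 => (‖z‖ ^ 2)⁻¹ * (‖e - z‖ ^ 2)⁻¹ := fun z => by
      simp only [Pi.zero_apply]; positivity
    refine lt_of_le_of_ne (integral_nonneg hnn) fun h => ?_
    have h0 := (integral_eq_zero_iff_of_nonneg hnn (integrable_inv_sq_mul_inv_sq he0)).1 h.symm
    have h1 : ∀ᵐ z : E3, z ≠ 0 := compl_mem_ae_iff.2 (measure_singleton 0)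
    have h2 : ∀ᵐ z : E3, z ≠ e := compl_mem_ae_iff.2 (measure_singleton e)
    obtain ⟨z, hz0, hz1, hz2⟩ := (h0.and (h1.and h2)).exists
    have h3 : 0 < ‖z‖ := norm_pos_iff.2 hz1
    have h4 : 0 < ‖e - z‖ := norm_pos_iff.2 (sub_ne_zero.2 hz2.symm)
    have : 0 < (‖z‖ ^ 2)⁻¹ * (‖e - z‖ ^ 2)⁻¹ := by positivity
    exact this.ne' hz0
  · have hp0 : 0 < ‖p‖ := norm_pos_iff.2 hp
    have h1 : ‖p‖ = ‖‖p‖ • e‖ := by rw [norm_smul, hne, norm_norm, mul_one]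
    rw [invSqConvolution_eq_of_norm_eq h1, invSqConvolution_smul hp0, mul_comm]

theorem integral_inv_sq_sub_mul_inv_sq_sub (x y : E3) :
    ∫ z : E3, (‖x - z‖ ^ 2)⁻¹ * (‖y - z‖ ^ 2)⁻¹ = invSqConvolution (x - y) := by
  rw [← integral_sub_left_eq_self _ volume x, invSqConvolution]
  refine integral_congr_ae (Eventually.of_forall fun z => ?_)
  simp only
  have : y - (x - z) = -(x - y - z) := by abel
  rw [sub_sub_cancel, this, norm_neg]

theorem integrable_inv_sq_sub_mul_inv_sq_sub {x y : E3} (h : x ≠ y) :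
    Integrable fun z : E3 => (‖x - z‖ ^ 2)⁻¹ * (‖y - z‖ ^ 2)⁻¹ := by
  have := (integrable_inv_sq_mul_inv_sq (sub_ne_zero.2 h)).comp_sub_left x
  refine this.congr (Eventually.of_forall fun z => ?_)
  simp only
  rw [norm_sub_rev y]
  congr 4
  abel

theorem ae_prod_ne (μ ν : Measure E3) [SFinite ν] [NullSingletonClass ν] :
    ∀ᵐ z : E3 × E3 ∂(μ.prod ν), z.1 ≠ z.2 := by
  have hm : MeasurableSet {z : E3 × E3 | z.1 = z.2} :=
    measurableSet_eq_fun measurable_fst measurable_snd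
  change (μ.prod ν) {z : E3 × E3 | ¬ z.1 ≠ z.2} = 0
  simp only [ne_eq, not_not]
  rw [Measure.measure_prod_null hm]
  refine Eventually.of_forall fun x => ?_
  have : Prod.mk x ⁻¹' {z : E3 × E3 | z.1 = z.2} = {x} := by
    ext y
    simp [eq_comm]
  simp [this]

/-- The Newtonian potential is a positive operator: writing the kernel as a multiple of the
self-convolution of `|z|⁻²` turns the energy into the integral of a square. -/
theorem integral_mul_newtonPotential_nonneg {D : Set E3} {f : E3 → ℝ}
    (hf : AEStronglyMeasurable f (volume.restrict D))
    (hint : Integrable (fun z : E3 × E3 => f z.1 * (newtonKernel z.1 z.2 * f z.2))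
      ((volume.restrict D).prod (volume.restrict D))) :
    0 ≤ ∫ x in D, f x * newtonPotential D f x := by
  obtain ⟨c, hc, hconv⟩ := exists_invSqConvolution_eq
  set μ := volume.restrict D with hμ
  set H : (E3 × E3) × E3 → ℝ := fun w =>
    (f w.1.1 * f w.1.2) * ((‖w.1.1 - w.2‖ ^ 2)⁻¹ * (‖w.1.2 - w.2‖ ^ 2)⁻¹) with hH
  have hnk : ∀ x y : E3, x ≠ y →
      invSqConvolution (x - y) = (4 * Real.pi * c) * newtonKernel x y := by
    intro x y hxy
    rw [hconv _ (sub_ne_zero.2 hxy), newtonKernel]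
    have : 0 < ‖x - y‖ := norm_pos_iff.2 (sub_ne_zero.2 hxy)
    field_simp
  have hne := ae_prod_ne μ μ
  have hHm : AEStronglyMeasurable H ((μ.prod μ).prod volume) := by
    have h1 : AEStronglyMeasurable (fun z : E3 × E3 => f z.1 * f z.2) (μ.prod μ) :=
      (hf.comp_quasiMeasurePreserving Measure.quasiMeasurePreserving_fst).mul
        (hf.comp_quasiMeasurePreserving Measure.quasiMeasurePreserving_snd)
    refine (h1.comp_quasiMeasurePreserving Measure.quasiMeasurePreserving_fst).mul ?_
    exact Measurable.aestronglyMeasurable (by fun_prop)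
  have hHi : Integrable H ((μ.prod μ).prod volume) := by
    rw [integrable_prod_iff hHm]
    refine ⟨?_, ?_⟩
    · filter_upwards [hne] with z hz
      exact (integrable_inv_sq_sub_mul_inv_sq_sub hz).const_mul (f z.1 * f z.2)
    · refine (hint.norm.const_mul (4 * Real.pi * c)).congr ?_
      filter_upwards [hne] with z hz
      have e : ∀ w : E3, ‖H (z, w)‖
          = ‖f z.1 * f z.2‖ * ((‖z.1 - w‖ ^ 2)⁻¹ * (‖z.2 - w‖ ^ 2)⁻¹) := fun w => by
        rw [hH, norm_mul, Real.norm_of_nonneg (by positivity : 0 ≤ (‖z.1 - w‖ ^ 2)⁻¹ * _)]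
      simp only [e, integral_const_mul, integral_inv_sq_sub_mul_inv_sq_sub, hnk _ _ hz]
      have hk : 0 ≤ newtonKernel z.1 z.2 := by unfold newtonKernel; positivity
      simp only [norm_mul, Real.norm_of_nonneg hk]
      ring
  have h1 : ∫ w, H w ∂((μ.prod μ).prod volume)
      = (4 * Real.pi * c) * ∫ x in D, f x * newtonPotential D f x := by
    rw [integral_prod _ hHi]
    have h2 : ∫ x in D, f x * newtonPotential D f x
        = ∫ z, f z.1 * (newtonKernel z.1 z.2 * f z.2) ∂(μ.prod μ) := by
      rw [integral_prod _ hint]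
      simp only [integral_const_mul, newtonPotential, hμ]
    rw [h2, ← integral_const_mul]
    refine integral_congr_ae ?_
    filter_upwards [hne] with z hz
    simp only [hH, integral_const_mul, integral_inv_sq_sub_mul_inv_sq_sub, hnk _ _ hz]
    ring
  have h3 : 0 ≤ ∫ w, H w ∂((μ.prod μ).prod volume) := by
    rw [integral_prod_symm _ hHi]
    refine integral_nonneg fun z => ?_
    have e : ∀ w : E3 × E3, H (w, z)
        = (f w.1 * (‖w.1 - z‖ ^ 2)⁻¹) * (f w.2 * (‖w.2 - z‖ ^ 2)⁻¹) := fun w => by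
      simp only [hH]; ring
    simp only [e]
    rw [integral_prod_mul (μ := μ) (ν := μ) (fun x => f x * (‖x - z‖ ^ 2)⁻¹)
      (fun x => f x * (‖x - z‖ ^ 2)⁻¹)]
    exact mul_self_nonneg _
  rw [h1] at h3
  exact nonneg_of_mul_nonneg_right h3 (by positivity)

/-! ### The space `H¹(D)`, cubes of its functions, and the energy -/

/-- The weak gradient on an open set is unique, so an element of `H¹(D)` is determined by its
underlying function. -/
theorem H1.ext_valueOf {D : Set E3} (hD : IsOpen D) {u w : H1 D}
    (h : valueOf u =ᵐ[volume.restrict D] valueOf w) : u = w := by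
  have h1 : u.1.fst = w.1.fst := Lp.ext h
  have hi : ∀ i : Fin 3, ∀ᵐ x ∂(volume.restrict D), (u.1.snd x - w.1.snd x) i = 0 := by
    intro i
    set e : E3 := EuclideanSpace.basisFun (Fin 3) ℝ i with he
    have hm : MemLp (fun x => inner ℝ (u.1.snd x - w.1.snd x) e) 2 (volume.restrict D) :=
      ((Lp.memLp u.1.snd).sub (Lp.memLp w.1.snd)).inner_const e
    have hloc : LocallyIntegrableOn (fun x => inner ℝ (u.1.snd x - w.1.snd x) e) D volume := by
      refine (locallyIntegrableOn_iff hD.isLocallyClosed).2 fun k hk hkc => ?_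
      have : IsFiniteMeasure (volume.restrict k) := ⟨by simpa using hkc.measure_lt_top⟩
      exact (hm.mono_measure (Measure.restrict_mono hk le_rfl)).integrable (by norm_num)
    have h2 := hD.ae_eq_zero_of_integral_contDiff_smul_eq_zero hloc ?_
    · rw [ae_restrict_iff' hD.measurableSet]
      filter_upwards [h2] with x hx hxD
      have := hx hxD
      rw [he, real_inner_comm, EuclideanSpace.basisFun_inner] at this
      exact this
    · intro φ h1' h2' h3'
      rw [← setIntegral_eq_integral_of_forall_compl_eq_zero (s := D) fun x hx => by
        rw [image_eq_zero_of_notMem_tsupport fun h => hx (h3' h), zero_smul]]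
      have e1 := u.2 φ h1' h2' h3' e
      have e2 := w.2 φ h1' h2' h3' e
      rw [h1] at e1
      have e3 : ∫ x in D, φ x * inner ℝ (u.1.snd x) e = ∫ x in D, φ x * inner ℝ (w.1.snd x) e := by
        linarith
      simp only [inner_sub_left, smul_eq_mul, mul_sub]
      rw [integral_sub (integrable_test_right h1' h2' e _) (integrable_test_right h1' h2' e _), e3,
        sub_self]
  have h2 : u.1.snd = w.1.snd := by
    refine Lp.ext ?_
    filter_upwards [ae_all_iff.2 hi] with x hx
    ext i
    exact sub_eq_zero.1 (hx i)
  refine Subtype.ext ?_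
  refine (WithLp.equiv 2 _).injective ?_
  exact Prod.ext h1 h2

/-- `H¹(D)` is closed because each defining identity is an equality of `L²` inner products. -/
theorem isClosed_H1 (D : Set E3) : IsClosed
    (H1 D : Set (WithLp 2 (Lp ℝ 2 (volume.restrict D) × Lp E3 2 (volume.restrict D)))) := by
  have : (H1 D : Set (WithLp 2 (Lp ℝ 2 (volume.restrict D) × Lp E3 2 (volume.restrict D))))
      = ⋂ (φ : E3 → ℝ) (_ : ContDiff ℝ ∞ φ) (_ : HasCompactSupport φ) (_ : tsupport φ ⊆ D)
        (v : E3), {p | ∫ x in D, p.fst x * fderiv ℝ φ x v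
          = -∫ x in D, φ x * inner ℝ (p.snd x) v} := by
    ext p
    simp only [mem_iInter, Set.mem_ofPred_eq]
    rfl
  rw [this]
  refine isClosed_iInter fun φ => isClosed_iInter fun h1 => isClosed_iInter fun h2 =>
    isClosed_iInter fun h3 => isClosed_iInter fun v => ?_
  have hψ : MemLp (fun x => fderiv ℝ φ x v) 2 (volume.restrict D) :=
    ((((h1.continuous_fderiv (by simp)).clm_apply continuous_const).memLp_of_hasCompactSupport
      (h2.fderiv_apply (𝕜 := ℝ) v)).restrict D)
  have hφ : MemLp (fun x => φ x • v) 2 (volume.restrict D) :=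
    ((h1.continuous.smul continuous_const).memLp_of_hasCompactSupport h2.smul_right).restrict D
  have e1 : ∀ p : WithLp 2 (Lp ℝ 2 (volume.restrict D) × Lp E3 2 (volume.restrict D)),
      ∫ x in D, p.fst x * fderiv ℝ φ x v = inner ℝ (hψ.toLp _) p.fst := by
    intro p
    rw [L2.inner_def]
    refine integral_congr_ae ?_
    filter_upwards [hψ.coeFn_toLp] with x hx
    rw [hx]
    simp
  have e2 : ∀ p : WithLp 2 (Lp ℝ 2 (volume.restrict D) × Lp E3 2 (volume.restrict D)),
      ∫ x in D, φ x * inner ℝ (p.snd x) v = inner ℝ (hφ.toLp _) p.snd := by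
    intro p
    rw [L2.inner_def]
    refine integral_congr_ae ?_
    filter_upwards [hφ.coeFn_toLp] with x hx
    rw [hx, real_inner_smul_left, real_inner_comm]
  simp only [e1, e2]
  refine isClosed_eq ?_ ?_
  · exact continuous_const.inner (WithLp.continuous_fst ..)
  · exact (continuous_const.inner (WithLp.continuous_snd ..)).neg

instance (D : Set E3) : CompleteSpace (H1 D) := (isClosed_H1 D).completeSpace_coe

theorem norm_fst_le_H1 {D : Set E3} (u : H1 D) : ‖u.1.fst‖ ≤ ‖u‖ := by
  rw [Submodule.coe_norm, WithLp.prod_norm_eq_of_L2]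
  exact Real.le_sqrt_of_sq_le (by nlinarith [sq_nonneg ‖u.1.snd‖])

theorem norm_snd_le_H1 {D : Set E3} (u : H1 D) : ‖u.1.snd‖ ≤ ‖u‖ := by
  rw [Submodule.coe_norm, WithLp.prod_norm_eq_of_L2]
  exact Real.le_sqrt_of_sq_le (by nlinarith [sq_nonneg ‖u.1.fst‖])

/-- The Sobolev embedding of `H¹(D)` into `L⁴(D)` in terms of the norm of `H¹(D)`. -/
theorem exists_sobolev_H1 {D : Set E3} (hDm : MeasurableSet D)
    (hb : Bornology.IsBounded D) (hcone : ConeCondition D) :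
    ∃ S : ℝ, 0 ≤ S ∧ ∀ u : H1 D, MemLp (valueOf u) 4 (volume.restrict D) ∧
      eLpNorm (valueOf u) 4 (volume.restrict D) ≤ ENNReal.ofReal (S * ‖u‖) := by
  obtain ⟨C, hC, h⟩ := exists_eLpNorm_four_le hDm hb hcone
  refine ⟨2 * C.toReal, by positivity, fun u => ?_⟩
  have h1 := h (valueOf u) u.1.snd (Lp.memLp u.1.fst) (Lp.memLp u.1.snd) u.2
  have e1 : eLpNorm (valueOf u) 2 (volume.restrict D) ≤ ENNReal.ofReal ‖u‖ := by
    have := norm_fst_le_H1 u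
    rw [Lp.norm_def] at this
    exact (ENNReal.le_ofReal_iff_toReal_le (Lp.eLpNorm_ne_top _) (norm_nonneg _)).2 this
  have e2 : eLpNorm u.1.snd 2 (volume.restrict D) ≤ ENNReal.ofReal ‖u‖ := by
    have := norm_snd_le_H1 u
    rw [Lp.norm_def] at this
    exact (ENNReal.le_ofReal_iff_toReal_le (Lp.eLpNorm_ne_top _) (norm_nonneg _)).2 this
  have h2 : eLpNorm (valueOf u) 4 (volume.restrict D) ≤ ENNReal.ofReal (2 * C.toReal * ‖u‖) := by
    refine h1.trans ((mul_le_mul' le_rfl (add_le_add e1 e2)).trans (le_of_eq ?_))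
    rw [← ENNReal.ofReal_add (norm_nonneg _) (norm_nonneg _)]
    nth_rw 1 [← ENNReal.ofReal_toReal hC]
    rw [← ENNReal.ofReal_mul ENNReal.toReal_nonneg]
    congr 1
    ring
  exact ⟨⟨(Lp.memLp u.1.fst).aestronglyMeasurable, h2.trans_lt ENNReal.ofReal_lt_top⟩, h2⟩

instance holderTriple_four_four_two : ENNReal.HolderTriple 4 4 2 where
  inv_add_inv_eq_inv := by
    refine (ENNReal.toReal_eq_toReal_iff' (by simp) (by simp)).1 ?_
    rw [ENNReal.toReal_add (by simp) (by simp)]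
    norm_num

instance holderTriple_four_two_four_thirds : ENNReal.HolderTriple 4 2 (4 / 3) where
  inv_add_inv_eq_inv := by
    refine (ENNReal.toReal_eq_toReal_iff' (by simp) (by simp [ENNReal.div_eq_zero_iff])).1 ?_
    rw [ENNReal.toReal_add (by simp) (by simp)]
    norm_num

instance holderTriple_four_thirds_four_one : ENNReal.HolderTriple (4 / 3) 4 1 where
  inv_add_inv_eq_inv := by
    refine (ENNReal.toReal_eq_toReal_iff' (by simp [ENNReal.div_eq_zero_iff]) (by simp)).1 ?_
    rw [ENNReal.toReal_add (by simp [ENNReal.div_eq_zero_iff]) (by simp)]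
    norm_num

section Cube

variable {α : Type*} [MeasurableSpace α] {μ : Measure α} {u w : α → ℝ}

theorem MeasureTheory.MemLp.cube (hu : MemLp u 4 μ) : MemLp (fun x => u x ^ 3) (4 / 3) μ := by
  have h := (hu.mul' (r := 2) hu).mul' (r := 4 / 3) hu
  refine h.congr_norm (hu.aestronglyMeasurable.pow 3) (Eventually.of_forall fun x => ?_)
  congr 1
  ring

theorem eLpNorm_cube_sub_cube_le (hu : MemLp u 4 μ) (hw : MemLp w 4 μ) :
    eLpNorm (fun x => u x ^ 3 - w x ^ 3) (4 / 3) μ ≤ eLpNorm (fun x => u x - w x) 4 μ *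
      (eLpNorm u 4 μ ^ 2 + eLpNorm u 4 μ * eLpNorm w 4 μ + eLpNorm w 4 μ ^ 2) := by
  have hum := hu.aestronglyMeasurable
  have hwm := hw.aestronglyMeasurable
  have e : (fun x => u x ^ 3 - w x ^ 3)
      = (fun x => u x - w x) • (u • u + u • w + w • w) := by
    ext x
    simp only [Pi.smul_apply', Pi.add_apply, Pi.mul_apply, smul_eq_mul]
    ring
  rw [e]
  refine (eLpNorm_smul_le_mul_eLpNorm (p := 4) (q := 2) (((hum.smul hum).add (hum.smul hwm)).add
    (hwm.smul hwm)) (hum.sub hwm)).trans ?_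
  refine mul_le_mul' le_rfl ?_
  refine (eLpNorm_add_le ((hum.smul hum).add (hum.smul hwm)) (hwm.smul hwm) (by norm_num)).trans ?_
  refine add_le_add ((eLpNorm_add_le (hum.smul hum) (hum.smul hwm) (by norm_num)).trans ?_) ?_
  · refine add_le_add ?_ ?_
    · rw [sq]
      exact eLpNorm_smul_le_mul_eLpNorm (p := 4) (q := 4) hum hum
    · exact eLpNorm_smul_le_mul_eLpNorm (p := 4) (q := 4) hwm hum
  · rw [sq]
    exact eLpNorm_smul_le_mul_eLpNorm (p := 4) (q := 4) hwm hwm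

theorem toReal_eLpNorm_cube_sub_cube_le (hu : MemLp u 4 μ) (hw : MemLp w 4 μ) {a b d : ℝ}
    (ha0 : 0 ≤ a) (hb0 : 0 ≤ b) (hd0 : 0 ≤ d) (ha : eLpNorm u 4 μ ≤ ENNReal.ofReal a)
    (hb : eLpNorm w 4 μ ≤ ENNReal.ofReal b)
    (hd : eLpNorm (fun x => u x - w x) 4 μ ≤ ENNReal.ofReal d) :
    (eLpNorm (fun x => u x ^ 3 - w x ^ 3) (4 / 3) μ).toReal ≤ d * (a ^ 2 + a * b + b ^ 2) := by
  refine ENNReal.toReal_le_of_le_ofReal (by positivity) ?_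
  refine (eLpNorm_cube_sub_cube_le hu hw).trans ?_
  rw [ENNReal.ofReal_mul hd0, ENNReal.ofReal_add (by positivity) (by positivity),
    ENNReal.ofReal_add (by positivity) (by positivity), ENNReal.ofReal_pow ha0,
    ENNReal.ofReal_pow hb0, ENNReal.ofReal_mul ha0]
  gcongr

end Cube

theorem newtonPotential_sub {D : Set E3} {f g : E3 → ℝ} {x : E3}
    (hf : IntegrableOn (fun s => newtonKernel x s * f s) D)
    (hg : IntegrableOn (fun s => newtonKernel x s * g s) D) :
    newtonPotential D (fun s => f s - g s) x = newtonPotential D f x - newtonPotential D g x := by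
  simp only [newtonPotential, mul_sub]
  exact integral_sub hf hg

theorem valueOf_sub_ae {D : Set E3} (u w : H1 D) :
    valueOf (u - w) =ᵐ[volume.restrict D] fun x => valueOf u x - valueOf w x :=
  Lp.coeFn_sub u.1.fst w.1.fst

theorem valueOf_ae_of_eq_smul_add_smul {D : Set E3} {a b : ℝ} {u w y : H1 D}
    (hy : a • u + b • w = y) :
    valueOf y =ᵐ[volume.restrict D] fun x => a * valueOf u x + b * valueOf w x := by
  subst hy
  filter_upwards [Lp.coeFn_add (a • u.1.fst) (b • w.1.fst), Lp.coeFn_smul a u.1.fst,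
    Lp.coeFn_smul b w.1.fst] with x h1 h2 h3
  change (a • u.1.fst + b • w.1.fst) x = _
  rw [h1, Pi.add_apply, h2, h3]
  rfl

/-- The energy of a function in `L^{4/3}(D)` converges absolutely, since the Newtonian potential
of `|f|` lies in `H¹(D)`, hence in `L⁴(D)`. -/
theorem integrable_mul_newtonKernel_mul {D : Set E3} (hDm : MeasurableSet D)
    (hb : Bornology.IsBounded D) (hcone : ConeCondition D) {f : E3 → ℝ}
    (hf : MemLp f (4 / 3) (volume.restrict D)) :
    Integrable (fun z : E3 × E3 => f z.1 * (newtonKernel z.1 z.2 * f z.2))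
      ((volume.restrict D).prod (volume.restrict D)) := by
  obtain ⟨C, -, hpot⟩ := exists_newtonPotential_mem_H1 hDm hb
  obtain ⟨S, -, hS⟩ := exists_sobolev_H1 hDm hb hcone
  have hfm := hf.aestronglyMeasurable
  obtain ⟨h1, -⟩ := hpot f hf
  obtain ⟨-, w, hw, -⟩ := hpot (fun x => ‖f x‖) hf.norm
  have hN : MemLp (newtonPotential D fun x => ‖f x‖) 4 (volume.restrict D) :=
    (memLp_congr_ae hw).1 (hS w).1
  have hm : AEStronglyMeasurable (fun z : E3 × E3 => f z.1 * (newtonKernel z.1 z.2 * f z.2))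
      ((volume.restrict D).prod (volume.restrict D)) :=
    (hfm.comp_quasiMeasurePreserving Measure.quasiMeasurePreserving_fst).mul
      (aestronglyMeasurable_newtonKernel_mul hfm)
  rw [integrable_prod_iff hm]
  refine ⟨?_, ?_⟩
  · filter_upwards [h1] with x hx using hx.const_mul _
  · refine (memLp_one_iff_integrable.1 (hN.mul' (r := 1) hf.norm)).congr
      (Eventually.of_forall fun x => ?_)
    simp only [norm_mul, integral_const_mul, newtonPotential]
    congr 1
    refine integral_congr_ae (Eventually.of_forall fun s => ?_)
    have hk : 0 ≤ newtonKernel x s := by unfold newtonKernel; positivity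
    simp only [Real.norm_of_nonneg hk]

/-! ### The operator `F` on `H¹(D)` -/

/-- `N` is the operator `u ↦ F(u)` on `H¹(D)`: the integral defining `F(u)` converges absolutely
almost everywhere, and `N` satisfies the Lipschitz bound of a cubic
map with constant `K`. -/
structure IsCubicPotentialOperator {D : Set E3} (K : ℝ) (N : H1 D → H1 D) : Prop where
  nonneg : 0 ≤ K
  integrable : ∀ u : H1 D, ∀ᵐ x ∂(volume.restrict D),
    IntegrableOn (fun s => newtonKernel x s * valueOf u s ^ 3) D
  valueOf_ae : ∀ u, valueOf (N u) =ᵐ[volume.restrict D] cubicPotential D (valueOf u)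
  map_zero : N 0 = 0
  norm_sub_le : ∀ u w, ‖N u - N w‖ ≤ K * ‖u - w‖ * (‖u‖ ^ 2 + ‖u‖ * ‖w‖ + ‖w‖ ^ 2)

theorem exists_isCubicPotentialOperator {D : Set E3} (hDm : MeasurableSet D) (hDo : IsOpen D)
    (hb : Bornology.IsBounded D) (hcone : ConeCondition D) :
    ∃ (K : ℝ) (N : H1 D → H1 D), IsCubicPotentialOperator K N := by
  obtain ⟨C, hC, hpot⟩ := exists_newtonPotential_mem_H1 hDm hb
  obtain ⟨S, hS0, hS⟩ := exists_sobolev_H1 hDm hb hcone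
  have hcube : ∀ u : H1 D, MemLp (fun x => valueOf u x ^ 3) (4 / 3) (volume.restrict D) :=
    fun u => (hS u).1.cube
  have hint : ∀ u : H1 D, ∀ᵐ x ∂(volume.restrict D),
      IntegrableOn (fun s => newtonKernel x s * valueOf u s ^ 3) D :=
    fun u => (hpot (fun x => valueOf u x ^ 3) (hcube u)).1
  have hex : ∀ u : H1 D, ∃ y : H1 D,
      valueOf y =ᵐ[volume.restrict D] cubicPotential D (valueOf u) := fun u =>
    (hpot (fun x => valueOf u x ^ 3) (hcube u)).2.imp fun _ hy => hy.1
  choose N hNv using hex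
  have hlip : ∀ u w, ‖N u - N w‖
      ≤ C * S ^ 3 * ‖u - w‖ * (‖u‖ ^ 2 + ‖u‖ * ‖w‖ + ‖w‖ ^ 2) := by
    intro u w
    have hex' := (hpot (fun x => valueOf u x ^ 3 - valueOf w x ^ 3)
      ((hcube u).sub (hcube w))).2
    obtain ⟨y, hy, hyn⟩ := hex'
    have hyN : N u - N w = y := by
      refine H1.ext_valueOf hDo ?_
      filter_upwards [valueOf_sub_ae (N u) (N w), hNv u, hNv w, hy, hint u, hint w]
        with x h1 h2 h3 h4 h5 h6
      rw [h1, h2, h3, h4, newtonPotential_sub h5 h6]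
      rfl
    have h7 := toReal_eLpNorm_cube_sub_cube_le (hS u).1 (hS w).1
      (mul_nonneg hS0 (norm_nonneg u)) (mul_nonneg hS0 (norm_nonneg w))
      (mul_nonneg hS0 (norm_nonneg (u - w))) (hS u).2 (hS w).2
      ((eLpNorm_congr_ae (valueOf_sub_ae u w)).symm.trans_le (hS (u - w)).2)
    refine (congrArg norm hyN).trans_le
      (hyn.trans ((mul_le_mul_of_nonneg_left h7 hC).trans (le_of_eq ?_)))
    ring
  have hN0 : N 0 = 0 := by
    refine H1.ext_valueOf hDo ?_
    have hz : valueOf (0 : H1 D) =ᵐ[volume.restrict D] 0 := Lp.coeFn_zero ℝ 2 _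
    filter_upwards [hNv 0, hz] with x h1 h2
    rw [h1, h2, cubicPotential, Pi.zero_apply]
    refine integral_eq_zero_of_ae ?_
    filter_upwards [hz] with s hs
    simp [hs]
  exact ⟨C * S ^ 3, N, mul_nonneg hC (pow_nonneg hS0 3), hint, hNv, hN0, hlip⟩

/-! ### Uniqueness -/

/-- Solutions are unique because `u ↦ u³` is monotone and the Newtonian potential is a positive
operator. -/
theorem ae_eq_of_cubic_equation {D : Set E3} (hDm : MeasurableSet D)
    (hb : Bornology.IsBounded D) (hcone : ConeCondition D) {ε : ℝ} (hε : 0 < ε) {h u w : E3 → ℝ}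
    (hu4 : MemLp u 4 (volume.restrict D)) (hw4 : MemLp w 4 (volume.restrict D))
    (hu : ∀ᵐ x ∂(volume.restrict D), IntegrableOn (fun s => newtonKernel x s * u s ^ 3) D ∧
      u x = -ε⁻¹ * cubicPotential D u x + ε * h x)
    (hw : ∀ᵐ x ∂(volume.restrict D), IntegrableOn (fun s => newtonKernel x s * w s ^ 3) D ∧
      w x = -ε⁻¹ * cubicPotential D w x + ε * h x) : u =ᵐ[volume.restrict D] w := by
  set f : E3 → ℝ := fun x => u x ^ 3 - w x ^ 3 with hf
  have hfm : MemLp f (4 / 3) (volume.restrict D) := hu4.cube.sub hw4.cube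
  have hdm : MemLp (fun x => u x - w x) 4 (volume.restrict D) :=
    hu4.sub hw4
  have hpos := integral_mul_newtonPotential_nonneg hfm.aestronglyMeasurable
    (integrable_mul_newtonKernel_mul hDm hb hcone hfm)
  have hint : Integrable (fun x => f x * (u x - w x)) (volume.restrict D) :=
    memLp_one_iff_integrable.1 (hdm.mul' (r := 1) hfm)
  have hnn : ∀ x, 0 ≤ f x * (u x - w x) := by
    intro x
    have : f x * (u x - w x) = (u x - w x) ^ 2 *
        ((u x + w x / 2) ^ 2 + 3 / 4 * w x ^ 2) := by
      simp only [hf]; ring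
    rw [this]
    positivity
  have heq : ∫ x in D, f x * (u x - w x)
      = -ε⁻¹ * ∫ x in D, f x * newtonPotential D f x := by
    rw [← integral_const_mul]
    refine integral_congr_ae ?_
    filter_upwards [hu, hw] with x h1 h2
    have h3 : newtonPotential D f x = cubicPotential D (u) x
        - cubicPotential D (w) x := newtonPotential_sub h1.1 h2.1
    have h4 : u x - w x = -ε⁻¹ * newtonPotential D f x := by
      rw [h3, h1.2, h2.2]
      ring
    rw [h4]
    ring
  have hzero : ∫ x in D, f x * (u x - w x) = 0 := by
    refine le_antisymm ?_ (integral_nonneg hnn)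
    rw [heq, neg_mul]
    exact neg_nonpos.2 (mul_nonneg (by positivity) hpos)
  filter_upwards [(integral_eq_zero_iff_of_nonneg hnn hint).1 hzero] with x hx
  rcases mul_eq_zero.1 (show f x * (u x - w x) = 0 from hx) with h1 | h1
  · exact (Odd.strictMono_pow (by decide : Odd 3)).injective (sub_eq_zero.1 h1)
  · exact sub_eq_zero.1 h1

theorem IsSolution.unique {D : Set E3} (hDo : IsOpen D)
    (hb : Bornology.IsBounded D) (hcone : ConeCondition D) {ε : ℝ} (hε : 0 < ε) {h u w : H1 D}
    (hu : IsSolution ε h u) (hw : IsSolution ε h w) : u = w :=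
  let ⟨_, _, hS⟩ := exists_sobolev_H1 hDo.measurableSet hb hcone
  H1.ext_valueOf hDo
    (ae_eq_of_cubic_equation hDo.measurableSet hb hcone hε (hS u).1 (hS w).1 hu hw)

/-! ### Existence by contraction -/

/-- For a map `N` with a cubic Lipschitz bound, `u ↦ -τ⁻³ N u + τ³ h` contracts the ball of
radius `τ²` when `τ` is small. -/
theorem exists_isFixedPt_of_cubic {E : Type*} [NormedAddCommGroup E] [NormedSpace ℝ E]
    [CompleteSpace E] {N : E → E} {K : ℝ} (hK : 0 ≤ K) (hN0 : N 0 = 0)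
    (hlip : ∀ u w, ‖N u - N w‖ ≤ K * ‖u - w‖ * (‖u‖ ^ 2 + ‖u‖ * ‖w‖ + ‖w‖ ^ 2))
    {τ : ℝ} (hτ : 0 < τ) (hτK : τ * (6 * K + 2) ≤ 1) {h : E} (hh : ‖h‖ ≤ 1) :
    ∃ u, ‖u‖ ≤ τ ^ 2 ∧ -(τ ^ 3)⁻¹ • N u + τ ^ 3 • h = u := by
  have hN : ∀ u, ‖N u‖ ≤ K * ‖u‖ ^ 3 := by
    intro u
    have := hlip u 0
    rw [hN0, sub_zero, sub_zero, norm_zero] at this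
    linarith
  set Φ : E → E := fun u => -(τ ^ 3)⁻¹ • N u + τ ^ 3 • h with hΦ
  have hmaps : MapsTo Φ (Metric.closedBall 0 (τ ^ 2)) (Metric.closedBall 0 (τ ^ 2)) := by
    intro u hu
    rw [mem_closedBall_zero_iff] at hu ⊢
    calc ‖Φ u‖ ≤ (τ ^ 3)⁻¹ * ‖N u‖ + τ ^ 3 * ‖h‖ := by
          refine (norm_add_le _ _).trans (le_of_eq ?_)
          rw [norm_smul, norm_smul, norm_neg, norm_inv, Real.norm_of_nonneg (by positivity)]
      _ ≤ (τ ^ 3)⁻¹ * (K * (τ ^ 2) ^ 3) + τ ^ 3 * 1 := by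
          gcongr
          exact (hN u).trans (by gcongr)
      _ = τ ^ 2 * (τ * (K + 1)) := by field_simp
      _ ≤ τ ^ 2 * 1 := by
          gcongr
          nlinarith
      _ = τ ^ 2 := mul_one _
  have hcontr : ContractingWith (1 / 2) (hmaps.restrict Φ _ _) := by
    refine ⟨by norm_num, LipschitzWith.of_dist_le_mul fun u w => ?_⟩
    rw [Subtype.dist_eq, Subtype.dist_eq, dist_eq_norm, dist_eq_norm]
    have hu := mem_closedBall_zero_iff.1 u.2
    have hw := mem_closedBall_zero_iff.1 w.2
    have e : Φ u - Φ w = -(τ ^ 3)⁻¹ • (N u - N w) := by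
      simp only [hΦ, smul_sub]
      abel
    change ‖Φ u - Φ w‖ ≤ _
    rw [e, norm_smul, norm_neg, norm_inv, Real.norm_of_nonneg (by positivity)]
    calc (τ ^ 3)⁻¹ * ‖N u - N w‖
        ≤ (τ ^ 3)⁻¹ * (K * ‖(u : E) - w‖ *
          ((τ ^ 2) ^ 2 + τ ^ 2 * τ ^ 2 + (τ ^ 2) ^ 2)) := by
          gcongr
          exact (hlip u w).trans (by gcongr)
      _ = (3 * K * τ) * ‖(u : E) - w‖ := by field_simp; ring
      _ ≤ (1 / 2) * ‖(u : E) - w‖ := by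
          gcongr
          nlinarith
      _ = _ := by norm_num
  obtain ⟨u, hu, hfix, -⟩ := hcontr.exists_fixedPoint' (Metric.isClosed_closedBall.isComplete)
    hmaps (x := 0) (by simp; positivity) (edist_ne_top _ _)
  exact ⟨u, mem_closedBall_zero_iff.1 hu, hfix⟩

/-- The fixed point in terms of `ε = τ³`. -/
theorem exists_isFixedPt_norm_le_rpow {E : Type*} [NormedAddCommGroup E] [NormedSpace ℝ E]
    [CompleteSpace E] {N : E → E} {K : ℝ} (hK : 0 ≤ K) (hN0 : N 0 = 0)
    (hlip : ∀ u w, ‖N u - N w‖ ≤ K * ‖u - w‖ * (‖u‖ ^ 2 + ‖u‖ * ‖w‖ + ‖w‖ ^ 2))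
    {ε : ℝ} (hε : ε ∈ Ioo 0 ((6 * K + 2)⁻¹ ^ 3)) {h : E} (hh : ‖h‖ ≤ 1) :
    ∃ u, ‖u‖ ≤ ε ^ (2 / 3 : ℝ) ∧ -ε⁻¹ • N u + ε • h = u := by
  have hK0 : 0 < 6 * K + 2 := by positivity
  have hτ0 : 0 < ε ^ (1 / 3 : ℝ) := Real.rpow_pos_of_pos hε.1 _
  have hτ3 : (ε ^ (1 / 3 : ℝ)) ^ 3 = ε := by
    rw [← Real.rpow_natCast, ← Real.rpow_mul hε.1.le]
    norm_num
  have hτ2 : (ε ^ (1 / 3 : ℝ)) ^ 2 = ε ^ (2 / 3 : ℝ) := by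
    rw [← Real.rpow_natCast, ← Real.rpow_mul hε.1.le]
    norm_num
  have hτK : ε ^ (1 / 3 : ℝ) * (6 * K + 2) ≤ 1 := by
    have h1 : ε ^ (1 / 3 : ℝ) < (6 * K + 2)⁻¹ := by
      refine lt_of_pow_lt_pow_left₀ 3 (inv_pos.2 hK0).le ?_
      rw [hτ3]
      exact hε.2
    calc ε ^ (1 / 3 : ℝ) * (6 * K + 2) ≤ (6 * K + 2)⁻¹ * (6 * K + 2) := by gcongr
      _ = 1 := inv_mul_cancel₀ hK0.ne'
  have hex := exists_isFixedPt_of_cubic hK hN0 hlip hτ0 hτK hh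
  rwa [hτ2, hτ3] at hex

theorem IsCubicPotentialOperator.exists_isSolution {D : Set E3} {K : ℝ} {N : H1 D → H1 D}
    (hN : IsCubicPotentialOperator K N) {ε : ℝ} (hε : ε ∈ Ioo 0 ((6 * K + 2)⁻¹ ^ 3)) {h : H1 D}
    (hh : ‖h‖ ≤ 1) : ∃ u : H1 D, IsSolution ε h u ∧ ‖u‖ ≤ ε ^ (2 / 3 : ℝ) := by
  have hex := exists_isFixedPt_norm_le_rpow hN.nonneg hN.map_zero hN.norm_sub_le hε hh
  rcases hex with ⟨u, hu, hfix⟩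
  refine ⟨u, ?_, hu⟩
  filter_upwards [hN.integrable u, hN.valueOf_ae u, valueOf_ae_of_eq_smul_add_smul hfix]
    with x h2 h3 h4
  exact ⟨h2, by rw [h4, h3]⟩

theorem theorem3p1 (D : Set E3) (hD_open : IsOpen D) (hD_bdd : Bornology.IsBounded D)
    (hD_cone : ConeCondition D) :
    ∃ ε₀ : ℝ, 0 < ε₀ ∧
      ∀ h : H1 D, ‖h‖ = 1 →
        ∃ u : ℝ → H1 D,
          (∀ ε ∈ Ioo 0 ε₀,
            IsSolution ε h (u ε) ∧
            ‖u ε‖ ≤ ε ^ (2 / 3 : ℝ) ∧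
            ∀ v : H1 D, IsSolution ε h v → v = u ε) ∧
          Tendsto (fun ε => ‖u ε‖) (𝓝[>] 0) (𝓝 0) := by
  have hex := exists_isCubicPotentialOperator hD_open.measurableSet hD_open hD_bdd hD_cone
  rcases hex with ⟨K, N, hN⟩
  have hK := hN.nonneg
  have hε₀ : (0 : ℝ) < (6 * K + 2)⁻¹ ^ 3 := by positivity
  refine ⟨(6 * K + 2)⁻¹ ^ 3, hε₀, fun h hh => ?_⟩
  have key : ∀ ε ∈ Ioo 0 ((6 * K + 2)⁻¹ ^ 3), ∃ u : H1 D,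
      IsSolution ε h u ∧ ‖u‖ ≤ ε ^ (2 / 3 : ℝ) := fun ε hε =>
    hN.exists_isSolution hε hh.le
  choose! u hu hun using key
  refine ⟨u, fun ε hε => ⟨hu ε hε, hun ε hε, fun v hv =>
    hv.unique hD_open hD_bdd hD_cone hε.1 (hu ε hε)⟩, ?_⟩
  have hlim : Tendsto (fun ε : ℝ => ε ^ (2 / 3 : ℝ)) (𝓝[>] 0) (𝓝 0) := by
    have := (Real.continuousAt_rpow_const 0 (2 / 3 : ℝ) (Or.inr (by norm_num))).tendsto
    rw [Real.zero_rpow (by norm_num)] at this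
    exact this.mono_left nhdsWithin_le_nhds
  refine squeeze_zero' (Eventually.of_forall fun _ => norm_nonneg _) ?_ hlim
  filter_upwards [Ioo_mem_nhdsGT hε₀] with ε hε using hun ε hε
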